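/- Let $k$ be a field of characteristic zero and let $C$ be a Hopf algebra over $k$. Assume that $C$ is connected (its coradical, the sum of its simple subcoalgebras, is one-dimensional), that the space of primitive elements of $C$ is two-dimensional ($C$ is primitively-thin), and that $C$ has Gelfand–Kirillov dimension $3$. Let $x,y,z$ be any elements that generate $C$ as an algebra, such that $x$ and $y$ are primitive and $$\Delta(z)=1\otimes z+x\otimes y-y\otimes x+z\otimes 1 .$$ Let $C^+=\ker\epsilon$, let $\delta\colon C^+\to C^+\otimes C^+$, $\delta(c)=\Delta(c)-(1\otimes c+c\otimes 1)$, and let $\Omega C$ be the cobar construction of $C$: the tensor algebra of $C^+$, with $C^+$ in degree one, whose differential $\partial$ is the graded derivation extending $\delta$. Then the elements $$u=z\otimes x-x\otimes z+xy\otimes x+x\otimes xy,\qquad t=y\otimes z-z\otimes y+xy\otimes y+y\otimes xy$$ of $C^+\otimes C^+$ are $2$-cocycles of $\Omega C$, their classes span $H^2(\Omega C)$, and $\dim_k H^2(\Omega C)=2$. -/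

import Mathlib

open scoped TensorProduct

noncomputable section

/-! ### Growth of algebras -/

/-- The Gelfand–Kirillov dimension of a `k`-algebra `A`: the supremum, over all finite-dimensional
subspaces `V`, of `limsup_n log (dim (k + V + ⋯ + V ^ n)) / log n`.
Note that `(k + V) ^ n = k + V + ⋯ + V ^ n`. -/
def gkDim (k A : Type*) [Field k] [Ring A] [Algebra k A] : EReal :=
  ⨆ (V : Submodule k A) (_ : FiniteDimensional k V),
    Filter.limsup
      (fun n : ℕ =>
        ((Real.log (Module.finrank k ↥((1 ⊔ V) ^ n)) / Real.log n : ℝ) : EReal))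
      Filter.atTop

/-! ### Connected coalgebras and primitive elements -/

section Coalgebra

variable (k : Type*) {C : Type*} [Field k] [AddCommGroup C] [Module k C] [Coalgebra k C]

/-- A subspace `D` is a subcoalgebra when `Δ(D)` lies in (the image of) `D ⊗ D`. -/
def IsSubcoalgebra (D : Submodule k C) : Prop :=
  ∀ d ∈ D, Coalgebra.comul (R := k) d ∈
    LinearMap.range (TensorProduct.map D.subtype D.subtype)

/-- A simple subcoalgebra: nonzero, with no subcoalgebras other than `0` and itself. -/
def IsSimpleSubcoalgebra (D : Submodule k C) : Prop :=
  IsSubcoalgebra k D ∧ D ≠ ⊥ ∧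
    ∀ E : Submodule k C, IsSubcoalgebra k E → E ≤ D → E = ⊥ ∨ E = D

variable (C) in
/-- The coradical: the sum of all simple subcoalgebras. -/
def coradical : Submodule k C :=
  sSup {D : Submodule k C | IsSimpleSubcoalgebra k D}

variable (C) in
/-- A coalgebra is connected when its coradical is one-dimensional. -/
def IsConnectedCoalgebra : Prop :=
  Module.finrank k (coradical k C) = 1

end Coalgebra

section Hopf

variable (k : Type*) {C : Type*} [Field k] [Ring C] [HopfAlgebra k C]

/-- `x` is primitive when `Δ(x) = x ⊗ 1 + 1 ⊗ x`. -/
def IsPrimitiveElt (x : C) : Prop :=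
  Coalgebra.comul (R := k) x = x ⊗ₜ[k] 1 + 1 ⊗ₜ[k] x

variable (C) in
/-- The space `P(C)` of primitive elements. -/
def primitiveSubmodule : Submodule k C where
  carrier := {x | IsPrimitiveElt k x}
  add_mem' {a b} ha hb := by
    simp only [Set.mem_ofPred_eq, IsPrimitiveElt] at ha hb ⊢
    rw [map_add, ha, hb, TensorProduct.add_tmul, TensorProduct.tmul_add]
    abel
  zero_mem' := by simp [IsPrimitiveElt]
  smul_mem' c a ha := by
    simp only [Set.mem_ofPred_eq, IsPrimitiveElt] at ha ⊢
    rw [map_smul, ha, smul_add, TensorProduct.smul_tmul', TensorProduct.tmul_smul]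

variable (C) in
/-- A primitively-thin Hopf algebra: connected, with two-dimensional space of primitives. -/
structure IsPrimitivelyThin : Prop where
  connected : IsConnectedCoalgebra k C
  finrank_primitive : Module.finrank k (primitiveSubmodule k C) = 2

/-! ### The cobar construction -/

variable (C) in
/-- `C⁺`, the kernel of the counit. -/
def augKer : Submodule k C :=
  LinearMap.ker (Coalgebra.counit (R := k) (A := C))

/-- The projection `c ↦ c - ε(c) 1` of `C = k 1 ⊕ C⁺` onto `C⁺`. -/
def augProj : C →ₗ[k] augKer k C :=
  LinearMap.codRestrict (augKer k C)
    (LinearMap.id - (Algebra.linearMap k C).comp (Coalgebra.counit (R := k) (A := C)))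
    (fun c => by simp [augKer])

theorem augProj_coe (c : C) :
    (augProj k c : C) = c - algebraMap k C (Coalgebra.counit (R := k) c) := rfl

theorem augProj_of_mem {c : C} (hc : c ∈ augKer k C) : augProj k c = ⟨c, hc⟩ := by
  have h : Coalgebra.counit (R := k) c = 0 := hc
  ext
  simp [augProj_coe, h]

variable (C) in
/-- The reduced comultiplication `δ : C⁺ → C⁺ ⊗ C⁺`, the `C⁺ ⊗ C⁺` component of `Δ`; see
`reducedComul_eq` for the formula `δ(x) = Δ(x) - (1 ⊗ x + x ⊗ 1)`. -/
def reducedComul : augKer k C →ₗ[k] augKer k C ⊗[k] augKer k C :=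
  (TensorProduct.map (augProj k) (augProj k)).comp
    ((Coalgebra.comul (R := k) (A := C)).comp (augKer k C).subtype)

theorem reducedComul_eq (x : augKer k C) :
    TensorProduct.map (augKer k C).subtype (augKer k C).subtype (reducedComul k C x) =
      Coalgebra.comul (R := k) (x : C) - (1 ⊗ₜ[k] (x : C) + (x : C) ⊗ₜ[k] 1) := by
  obtain ⟨x, hx⟩ := x
  have hx0 : Coalgebra.counit (R := k) x = 0 := hx
  let R := Coalgebra.Repr.arbitrary k x
  have h1 : ∑ i ∈ R.index,
      (1 : C) ⊗ₜ[k] (algebraMap k C (Coalgebra.counit (R := k) (R.left i)) * R.right i)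
        = 1 ⊗ₜ[k] x := by
    rw [← TensorProduct.tmul_sum]
    congr 1
    simpa [Algebra.smul_def] using Coalgebra.sum_counit_smul R
  have h2 : ∑ i ∈ R.index,
      (R.left i * algebraMap k C (Coalgebra.counit (R := k) (R.right i))) ⊗ₜ[k] (1 : C)
        = x ⊗ₜ[k] 1 := by
    rw [← TensorProduct.sum_tmul]
    congr 1
    have h := congrArg (TensorProduct.rid k C) (Coalgebra.sum_tmul_counit_eq R)
    rw [map_sum, TensorProduct.rid_tmul, one_smul] at h
    refine Eq.trans ?_ h
    refine Finset.sum_congr rfl fun i _ => ?_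
    rw [TensorProduct.rid_tmul, Algebra.smul_def, Algebra.commutes]
  have h3 : ∑ i ∈ R.index,
      (algebraMap k C (Coalgebra.counit (R := k) (R.left i) *
        Coalgebra.counit (R := k) (R.right i))) ⊗ₜ[k] (1 : C) = 0 := by
    rw [← TensorProduct.sum_tmul, ← map_sum]
    have := congrArg (Coalgebra.counit (R := k)) (Coalgebra.sum_counit_smul R)
    simp only [map_sum, map_smul, smul_eq_mul, hx0] at this
    rw [this]; simp
  have hd : Coalgebra.comul (R := k) x = ∑ i ∈ R.index, R.left i ⊗ₜ[k] R.right i := R.eq.symm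
  have key : ∀ a b : C,
      (a - algebraMap k C (Coalgebra.counit (R := k) a)) ⊗ₜ[k]
        (b - algebraMap k C (Coalgebra.counit (R := k) b)) =
      a ⊗ₜ[k] b - (1 : C) ⊗ₜ[k] (algebraMap k C (Coalgebra.counit (R := k) a) * b)
        - (a * algebraMap k C (Coalgebra.counit (R := k) b)) ⊗ₜ[k] (1 : C)
        + (algebraMap k C (Coalgebra.counit (R := k) a * Coalgebra.counit (R := k) b))
          ⊗ₜ[k] (1 : C) := by
    intro a b
    rw [← Algebra.commutes (Coalgebra.counit (R := k) b) a]
    simp only [TensorProduct.sub_tmul, TensorProduct.tmul_sub, Algebra.algebraMap_eq_smul_one,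
      smul_mul_assoc, one_mul, TensorProduct.tmul_smul, TensorProduct.smul_tmul', mul_smul]
    rw [smul_sub, TensorProduct.smul_tmul', TensorProduct.smul_tmul', smul_comm]
    abel
  simp only [reducedComul, LinearMap.comp_apply, Submodule.subtype_apply, hd, map_sum,
    TensorProduct.map_tmul, augProj_coe, key, Finset.sum_add_distrib, Finset.sum_sub_distrib,
    h1, h2, h3]
  abel

variable (C) in
/-- The underlying algebra of the cobar construction `ΩC`: the tensor algebra of `C⁺`. -/
abbrev Cobar : Type _ := TensorAlgebra k (augKer k C)

variable (C) in
/-- The component `(C⁺)^{⊗ n}` of `ΩC`, of cohomological degree `n`. -/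
def cobarDegree (n : ℕ) : Submodule k (Cobar k C) :=
  LinearMap.range (TensorAlgebra.ι k : augKer k C →ₗ[k] Cobar k C) ^ n

/-- The element `[c]` of degree one of `ΩC` given by `c ∈ C`; it is `c` itself, placed in
degree one, when `c ∈ C⁺`, and in general it is the component of `c` in `C⁺`. -/
def cobarOne : C →ₗ[k] Cobar k C :=
  (TensorAlgebra.ι k).comp (augProj k)

theorem cobarOne_of_mem {c : C} (hc : c ∈ augKer k C) :
    cobarOne k c = TensorAlgebra.ι k (⟨c, hc⟩ : augKer k C) := by
  simp [cobarOne, augProj_of_mem k hc]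

variable (C) in
/-- `δ`, followed by the identification of `C⁺ ⊗ C⁺` with the degree two component of `ΩC`. -/
def cobarDelta : augKer k C →ₗ[k] Cobar k C :=
  (LinearMap.mul' k (Cobar k C)).comp
    ((TensorProduct.map (TensorAlgebra.ι k) (TensorAlgebra.ι k)).comp (reducedComul k C))

variable (C) in
/-- The algebra homomorphism `a ↦ !![(-1)^|a| a, ∂ a; 0, a]`. Multiplicativity of this map says
exactly that `∂(a b) = ∂(a) b + (-1)^|a| a ∂(b)`. -/
def cobarMatrix : Cobar k C →ₐ[k] Matrix (Fin 2) (Fin 2) (Cobar k C) :=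
  TensorAlgebra.lift k
    { toFun := fun v =>
        !![-TensorAlgebra.ι k v, cobarDelta k C v; 0, TensorAlgebra.ι k v]
      map_add' := fun v w => by
        ext i j; fin_cases i <;> fin_cases j <;> simp [add_comm]
      map_smul' := fun c v => by
        ext i j; fin_cases i <;> fin_cases j <;> simp }

variable (C) in
/-- The differential `∂` of `ΩC`: the graded derivation of the tensor algebra extending `δ`
(see `cobarDifferential_ι` and `cobarDifferential_mul`). -/
def cobarDifferential : Cobar k C →ₗ[k] Cobar k C where
  toFun a := cobarMatrix k C a 0 1
  map_add' a b := by simp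
  map_smul' c a := by simp

theorem cobarDifferential_ι (v : augKer k C) :
    cobarDifferential k C (TensorAlgebra.ι k v) = cobarDelta k C v := by
  simp [cobarDifferential, cobarMatrix]

theorem cobarMatrix_lower (a : Cobar k C) :
    cobarMatrix k C a 1 0 = 0 ∧ cobarMatrix k C a 1 1 = a := by
  induction a using TensorAlgebra.induction with
  | algebraMap r => simp [Matrix.algebraMap_matrix_apply]
  | ι v => simp [cobarMatrix]
  | mul a b ha hb => simp [Matrix.mul_apply, ha, hb]
  | add a b ha hb => simp [ha, hb]

theorem cobarMatrix_upper {n : ℕ} {a : Cobar k C} (ha : a ∈ cobarDegree k C n) :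
    cobarMatrix k C a 0 0 = (-1) ^ n * a := by
  induction ha using Submodule.pow_induction_on_left' with
  | algebraMap r => simp [Matrix.algebraMap_matrix_apply]
  | add x y i _ _ hx hy => simp [hx, hy, mul_add]
  | mem_mul m hm i x _ hx =>
    obtain ⟨v, rfl⟩ := hm
    have h0 : cobarMatrix k C (TensorAlgebra.ι k v) 0 0 = -TensorAlgebra.ι k v := by
      simp [cobarMatrix]
    have hc : (-1 : Cobar k C) ^ i * TensorAlgebra.ι k v =
        TensorAlgebra.ι k v * (-1) ^ i :=
      ((Commute.neg_one_left (TensorAlgebra.ι k v)).pow_left i)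
    rw [map_mul, Matrix.mul_apply, Fin.sum_univ_two, hx, h0, (cobarMatrix_lower k x).1, mul_zero,
      add_zero, pow_succ', neg_mul, neg_mul, one_mul, neg_mul, ← mul_assoc, ← mul_assoc, hc]

/-- The graded Leibniz rule. -/
theorem cobarDifferential_mul {n : ℕ} {a : Cobar k C} (ha : a ∈ cobarDegree k C n)
    (b : Cobar k C) :
    cobarDifferential k C (a * b) =
      cobarDifferential k C a * b + (-1) ^ n * a * cobarDifferential k C b := by
  change cobarMatrix k C (a * b) 0 1 =
    cobarMatrix k C a 0 1 * b + (-1) ^ n * a * cobarMatrix k C b 0 1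
  rw [map_mul, Matrix.mul_apply, Fin.sum_univ_two, (cobarMatrix_lower k b).2,
    cobarMatrix_upper k ha, add_comm]

theorem cobarDifferential_cobarOne (c : C) :
    cobarDifferential k C (cobarOne k c) =
      (LinearMap.mul' k (Cobar k C)).comp (TensorProduct.map (cobarOne k) (cobarOne k))
        (Coalgebra.comul (R := k) c) := by
  have h1 : augProj k (1 : C) = 0 := by ext; simp [augProj_coe]
  have hc : cobarOne k c = TensorAlgebra.ι k (augProj k c) := rfl
  rw [hc, cobarDifferential_ι]
  simp only [cobarDelta, reducedComul, LinearMap.comp_apply, Submodule.subtype_apply,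
    augProj_coe, map_sub, Algebra.algebraMap_eq_smul_one, map_smul, Bialgebra.comul_one,
    Algebra.TensorProduct.one_def, TensorProduct.map_tmul, h1, TensorProduct.zero_tmul,
    smul_zero, map_zero, sub_zero]
  rw [← LinearMap.comp_apply (TensorProduct.map _ _) (TensorProduct.map _ _),
    ← TensorProduct.map_comp]
  rfl

theorem cobarOne_mem (c : C) : cobarOne k c ∈ cobarDegree k C 1 := by
  rw [cobarDegree, pow_one]
  exact ⟨_, rfl⟩

theorem cobarOne_mul_cobarOne_mem (a b : C) :
    cobarOne k a * cobarOne k b ∈ cobarDegree k C 2 := by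
  rw [cobarDegree, pow_two]
  exact Submodule.mul_mem_mul ⟨_, rfl⟩ ⟨_, rfl⟩

/-- `∂ ∘ ∂ = 0`, so that coboundaries are cocycles. -/
theorem cobarDifferential_sq (a : Cobar k C) :
    cobarDifferential k C (cobarDifferential k C a) = 0 := by
  let ℓ : C →ₗ[k] Cobar k C := cobarOne k
  have hgen : ∀ c : C, cobarDifferential k C (cobarDifferential k C (cobarOne k c)) = 0 := by
    intro c
    let R := Coalgebra.Repr.arbitrary k c
    let a₁ := fun i : C × C => Coalgebra.Repr.arbitrary k (R.left i)
    let a₂ := fun i : C × C => Coalgebra.Repr.arbitrary k (R.right i)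
    have hd : ∀ (e : C) (S : Coalgebra.Repr k e (C × C)),
        cobarDifferential k C (cobarOne k e) = ∑ i ∈ S.index, ℓ (S.left i) * ℓ (S.right i) := by
      intro e S
      rw [cobarDifferential_cobarOne, ← S.eq]
      simp [ℓ]
    have h := congrArg ((LinearMap.mul' k (Cobar k C)).comp
      (TensorProduct.map LinearMap.id (LinearMap.mul' k (Cobar k C))))
      (Coalgebra.sum_map_tmul_tmul_eq (repr := R) ℓ ℓ ℓ c (a₁ := a₁) (a₂ := a₂))
    simp only [map_sum, LinearMap.comp_apply, TensorProduct.map_tmul, LinearMap.mul'_apply,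
      LinearMap.id_apply] at h
    rw [hd c R, map_sum]
    have : ∀ i ∈ R.index, cobarDifferential k C (ℓ (R.left i) * ℓ (R.right i)) =
        ∑ j ∈ (a₁ i).index, ℓ ((a₁ i).left j) * (ℓ ((a₁ i).right j) * ℓ (R.right i)) -
        ∑ j ∈ (a₂ i).index, ℓ (R.left i) * (ℓ ((a₂ i).left j) * ℓ ((a₂ i).right j)) := by
      intro i _
      rw [cobarDifferential_mul k (cobarOne_mem k (R.left i)), hd _ (a₁ i), hd _ (a₂ i),
        Finset.sum_mul, Finset.mul_sum, sub_eq_add_neg, ← Finset.sum_neg_distrib]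
      simp [mul_assoc, ℓ]
    rw [Finset.sum_congr rfl this, Finset.sum_sub_distrib, sub_eq_zero]
    exact h.symm
  suffices H : ∀ b : Cobar k C, cobarDifferential k C (cobarDifferential k C b) = 0 →
      cobarDifferential k C (cobarDifferential k C (a * b)) = 0 by
    have h1 : cobarDifferential k C 1 = 0 := by simp [cobarDifferential]
    simpa [h1] using H 1
  induction a using TensorAlgebra.induction with
  | algebraMap r => intro b hb; simp [Algebra.algebraMap_eq_smul_one, hb]
  | ι v =>
    intro b hb
    have hv : TensorAlgebra.ι k v = cobarOne k (v : C) := by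
      rw [cobarOne_of_mem k v.2]
    have hmem : cobarDifferential k C (cobarOne k (v : C)) ∈ cobarDegree k C 2 := by
      rw [cobarDifferential_cobarOne, ← (Coalgebra.Repr.arbitrary k (v : C)).eq, map_sum]
      refine Submodule.sum_mem _ fun i _ => ?_
      exact cobarOne_mul_cobarOne_mem k _ _
    rw [hv, cobarDifferential_mul k (cobarOne_mem k _), map_add, cobarDifferential_mul k hmem,
      hgen, pow_one, neg_one_mul, neg_mul, map_neg (cobarDifferential k C),
      cobarDifferential_mul k (cobarOne_mem k _), hb]
    simp
  | mul a a' ha ha' => intro b hb; rw [mul_assoc]; exact ha _ (ha' _ hb)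
  | add a a' ha ha' => intro b hb; rw [add_mul, map_add, map_add, ha b hb, ha' b hb, add_zero]

variable (C) in
/-- The cocycles of degree `n` of `ΩC`. -/
def cobarCocycles (n : ℕ) : Submodule k (Cobar k C) :=
  cobarDegree k C n ⊓ LinearMap.ker (cobarDifferential k C)

variable (C) in
/-- The coboundaries of degree `n` of `ΩC`. -/
def cobarCoboundaries : ℕ → Submodule k (Cobar k C)
  | 0 => ⊥
  | n + 1 => (cobarDegree k C n).map (cobarDifferential k C)

variable (C) in
/-- The `n`-th coalgebra cohomology `Hⁿ(ΩC)`: cocycles modulo coboundaries. -/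
abbrev CobarCohomology (n : ℕ) : Type _ :=
  ↥(cobarCocycles k C n) ⧸ (cobarCoboundaries k C n).submoduleOf (cobarCocycles k C n)

/-- The cohomology class of a cocycle. -/
def cobarClass {n : ℕ} (a : Cobar k C) (ha : a ∈ cobarCocycles k C n) :
    CobarCohomology k C n :=
  Submodule.Quotient.mk ⟨a, ha⟩

/-- `u = z ⊗ x - x ⊗ z + xy ⊗ x + x ⊗ xy`, in `(C⁺)^{⊗ 2}`. -/
def cobarU (x y z : C) : Cobar k C :=
  cobarOne k z * cobarOne k x - cobarOne k x * cobarOne k z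
    + cobarOne k (x * y) * cobarOne k x + cobarOne k x * cobarOne k (x * y)

/-- `t = y ⊗ z - z ⊗ y + xy ⊗ y + y ⊗ xy`, in `(C⁺)^{⊗ 2}`. -/
def cobarT (x y z : C) : Cobar k C :=
  cobarOne k y * cobarOne k z - cobarOne k z * cobarOne k y
    + cobarOne k (x * y) * cobarOne k y + cobarOne k y * cobarOne k (x * y)

end Hopf

end

/-! Dually, functionals on `C` multiply by convolution and act on `C` by `hit f c = f(c₂) c₁`. Give
`x`, `y` weight one and `z` weight two, and let `ξ`, `η` be functionals dual to `x`, `y` and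
vanishing at 1. Up to lower weight, `x`, `y`, `z` commute and `ξ`, `η` act as the vector fields `∂_x
- y ∂_z` and `∂_y + x ∂_z`, whose bracket is `2 ∂_z`: the Heisenberg Lie algebra. Its two defining
relations `[ξ,[ξ,η]] = 0` and `[η,[ξ,η]] = 0` account for the two dimensions of `H²`, and `u`, `t`
correspond to them.

The tool is Euler's identity (`ThinTriple.euler`): `x ξ + y η + z [ξ,η]` multiplies by the weight,
up to lower weight. In characteristic zero it shows that `ξ` and `η` detect the filtration
(`mem_of_hit_mem`), and it solves `ξ c = α`, `η c = β` to leading order whenever `[f, [ξ,η]] = 0`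
imposes no obstruction for `f = ξ, η` (`exists_hit_sub_mem`).

A 2-cocycle `w` is determined by its slices `α = (id ⊗ ξ) w` and `β = (id ⊗ η) w`
(`slice_eq_zero_imp`). Slices of a coboundary `∂[c]` are `ξ c` and `η c` up to constants, so making
`w` a coboundary means integrating `(α, β)`. The obstruction `f(ξβ - ηα) - [ξ,η](slice f w)` is
small enough once the slices have weight at least three (`obstruction_mem`), and vanishes for slices
of weight one. For slices of weight two it is a pair of constants, which multiples of `u` and `t`
remove, their obstructions being `(-4, 0)` and `(0, 4)`. Descent on the weight gives spanning
(`exists_eq_of_slice_mem`). The same constants give independence, because a coboundary with slices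
of weight two comes from some `c` of weight three, where the obstruction is exactly zero
(`eq_zero_of_eq_cobarDifferential`).

Gelfand–Kirillov dimension enters to make `x`, `y` independent: otherwise `z` is primitive and two
almost commuting primitives generate `C`, forcing growth at most quadratic (`gkDim_le_two`). -/

noncomputable section

namespace ThinHopf

/-! ### The weight filtration -/

section Filtration

variable (k : Type*) {C : Type*} [Field k] [Ring C] [Algebra k C] (x y z : C)

/-- Words in `x`, `y`, `z`, where `x` and `y` have weight one and `z` has weight two. -/
inductive IsWord : ℤ → C → Prop
  | one : IsWord 0 1
  | mul_x {n c} : IsWord n c → IsWord (n + 1) (x * c)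
  | mul_y {n c} : IsWord n c → IsWord (n + 1) (y * c)
  | mul_z {n c} : IsWord n c → IsWord (n + 2) (z * c)

/-- The span of the words of weight at most `n`. -/
def weightFil (n : ℤ) : Submodule k C :=
  Submodule.span k {c | ∃ m ≤ n, IsWord x y z m c}

variable {k x y z}

theorem weightFil_mono {m n : ℤ} (h : m ≤ n) : weightFil k x y z m ≤ weightFil k x y z n :=
  Submodule.span_mono fun _ ⟨i, hi, hc⟩ => ⟨i, hi.trans h, hc⟩

theorem mem_weightFil_of_le {m n : ℤ} (h : m ≤ n) {c : C} (hc : c ∈ weightFil k x y z m) :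
    c ∈ weightFil k x y z n :=
  weightFil_mono h hc

theorem IsWord.mem {n : ℤ} {c : C} (h : IsWord x y z n c) : c ∈ weightFil k x y z n :=
  Submodule.subset_span ⟨n, le_rfl, h⟩

theorem IsWord.nonneg {n : ℤ} {c : C} (h : IsWord x y z n c) : 0 ≤ n := by
  induction h <;> omega

theorem IsWord.eq_one {n : ℤ} {c : C} (h : IsWord x y z n c) (hn : n ≤ 0) : c = 1 := by
  cases h with
  | one => rfl
  | mul_x h => have := h.nonneg; omega
  | mul_y h => have := h.nonneg; omega
  | mul_z h => have := h.nonneg; omega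

/-- Weights are integers for the sake of this lemma: an error term of negative weight is exactly
zero, so congruences become equalities in low weight. -/
theorem weightFil_of_neg {n : ℤ} (h : n < 0) : weightFil k x y z n = ⊥ := by
  rw [weightFil, Submodule.span_eq_bot]
  rintro c ⟨m, hm, hc⟩
  have := hc.nonneg
  omega

theorem eq_zero_of_mem_weightFil {n : ℤ} (h : n < 0) {c : C} (hc : c ∈ weightFil k x y z n) :
    c = 0 := by
  rwa [weightFil_of_neg h, Submodule.mem_bot] at hc

theorem one_mem_weightFil {n : ℤ} (h : 0 ≤ n) : (1 : C) ∈ weightFil k x y z n :=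
  mem_weightFil_of_le h IsWord.one.mem

theorem mem_weightFil_zero {c : C} (h : c ∈ weightFil k x y z 0) : ∃ a : k, c = a • 1 := by
  rw [weightFil] at h
  induction h using Submodule.span_induction with
  | mem c hc =>
    obtain ⟨m, hm, hc⟩ := hc
    exact ⟨1, by rw [hc.eq_one hm, one_smul]⟩
  | zero => exact ⟨0, by simp⟩
  | add c d _ _ hc hd =>
    obtain ⟨a, rfl⟩ := hc
    obtain ⟨b, rfl⟩ := hd
    exact ⟨a + b, by rw [add_smul]⟩
  | smul r c _ hc =>
    obtain ⟨a, rfl⟩ := hc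
    exact ⟨r * a, by rw [mul_smul]⟩

theorem mem_weightFil_one {c : C} (h : c ∈ weightFil k x y z 1) :
    ∃ a b d : k, c = a • 1 + b • x + d • y := by
  rw [weightFil] at h
  induction h using Submodule.span_induction with
  | mem c hc =>
    obtain ⟨m, hm, hc⟩ := hc
    cases hc with
    | one => exact ⟨1, 0, 0, by simp⟩
    | mul_x h => exact ⟨0, 1, 0, by rw [h.eq_one (by omega)]; simp⟩
    | mul_y h => exact ⟨0, 0, 1, by rw [h.eq_one (by omega)]; simp⟩
    | mul_z h => have := h.nonneg; omega
  | zero => exact ⟨0, 0, 0, by simp⟩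
  | add c c' _ _ hc hc' =>
    obtain ⟨a, b, d, rfl⟩ := hc
    obtain ⟨a', b', d', rfl⟩ := hc'
    exact ⟨a + a', b + b', d + d', by simp only [add_smul]; abel⟩
  | smul r c _ hc =>
    obtain ⟨a, b, d, rfl⟩ := hc
    exact ⟨r * a, r * b, r * d, by simp only [mul_smul, smul_add]⟩

/-- The family `P` varies with the weight, so that a weight estimate can be proved one letter at a
time; `mono` is needed because the filtration also contains words of strictly smaller weight. -/
theorem weightFil_induction {P : ℤ → Submodule k C} (one : (1 : C) ∈ P 0)
    (mono : ∀ {m n : ℤ} {c : C}, m ≤ n → c ∈ weightFil k x y z m → c ∈ P m → c ∈ P n)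
    (mul_x : ∀ {n : ℤ} {c : C}, c ∈ weightFil k x y z n → c ∈ P n → x * c ∈ P (n + 1))
    (mul_y : ∀ {n : ℤ} {c : C}, c ∈ weightFil k x y z n → c ∈ P n → y * c ∈ P (n + 1))
    (mul_z : ∀ {n : ℤ} {c : C}, c ∈ weightFil k x y z n → c ∈ P n → z * c ∈ P (n + 2))
    (n : ℤ) : weightFil k x y z n ≤ P n := by
  have key : ∀ {m : ℤ} {c : C}, IsWord x y z m c → c ∈ P m := by
    intro m c h
    induction h with
    | one => exact one
    | mul_x h ih => exact mul_x h.mem ih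
    | mul_y h ih => exact mul_y h.mem ih
    | mul_z h ih => exact mul_z h.mem ih
  exact Submodule.span_le.2 fun c ⟨m, hm, hc⟩ => mono hm hc.mem (key hc)

theorem mul_mem_aux (w : C) (d : ℤ) (hw : ∀ {m : ℤ} {c : C}, IsWord x y z m c →
    IsWord x y z (m + d) (w * c)) {n : ℤ} {c : C} (hc : c ∈ weightFil k x y z n) :
    w * c ∈ weightFil k x y z (n + d) := by
  have : weightFil k x y z n ≤ (weightFil k x y z (n + d)).comap (LinearMap.mulLeft k w) :=
    Submodule.span_le.2 fun c ⟨m, hm, hc⟩ =>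
      mem_weightFil_of_le (by omega) (hw hc).mem
  exact this hc

theorem x_mul_mem {n : ℤ} {c : C} (hc : c ∈ weightFil k x y z n) :
    x * c ∈ weightFil k x y z (n + 1) :=
  mul_mem_aux x 1 IsWord.mul_x hc

theorem y_mul_mem {n : ℤ} {c : C} (hc : c ∈ weightFil k x y z n) :
    y * c ∈ weightFil k x y z (n + 1) :=
  mul_mem_aux y 1 IsWord.mul_y hc

theorem z_mul_mem {n : ℤ} {c : C} (hc : c ∈ weightFil k x y z n) :
    z * c ∈ weightFil k x y z (n + 2) :=
  mul_mem_aux z 2 IsWord.mul_z hc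

theorem x_mem : x ∈ weightFil k x y z 1 := by
  simpa using x_mul_mem (k := k) (x := x) (y := y) (z := z) (one_mem_weightFil le_rfl)

theorem y_mem : y ∈ weightFil k x y z 1 := by
  simpa using y_mul_mem (k := k) (x := x) (y := y) (z := z) (one_mem_weightFil le_rfl)

theorem z_mem : z ∈ weightFil k x y z 2 := by
  simpa using z_mul_mem (k := k) (x := x) (y := y) (z := z) (one_mem_weightFil le_rfl)

theorem mul_mem_weightFil {m n : ℤ} {a b : C} (ha : a ∈ weightFil k x y z m)
    (hb : b ∈ weightFil k x y z n) : a * b ∈ weightFil k x y z (m + n) := by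
  refine weightFil_induction
    (P := fun m => (weightFil k x y z (m + n)).comap (LinearMap.mulRight k b))
    ?_ ?_ ?_ ?_ ?_ m ha
  · simpa using hb
  · intro i j c hij _ hc
    exact mem_weightFil_of_le (by omega) hc
  · intro i c _ hc
    have := x_mul_mem hc
    simp only [LinearMap.mulRight_apply, Submodule.mem_comap, mul_assoc] at this ⊢
    exact mem_weightFil_of_le (by omega) this
  · intro i c _ hc
    have := y_mul_mem hc
    simp only [LinearMap.mulRight_apply, Submodule.mem_comap, mul_assoc] at this ⊢
    exact mem_weightFil_of_le (by omega) this
  · intro i c _ hc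
    have := z_mul_mem hc
    simp only [LinearMap.mulRight_apply, Submodule.mem_comap, mul_assoc] at this ⊢
    exact mem_weightFil_of_le (by omega) this

theorem exists_mem_weightFil (h : Algebra.adjoin k {x, y, z} = ⊤) (c : C) :
    ∃ n : ℕ, c ∈ weightFil k x y z n := by
  have hc : c ∈ Algebra.adjoin k {x, y, z} := h ▸ Algebra.mem_top
  induction hc using Algebra.adjoin_induction with
  | mem c hc =>
    refine ⟨2, ?_⟩
    rcases hc with rfl | rfl | rfl
    · exact mem_weightFil_of_le (by simp) x_mem
    · exact mem_weightFil_of_le (by simp) y_mem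
    · exact z_mem
  | algebraMap r =>
    rw [Algebra.algebraMap_eq_smul_one]
    exact ⟨0, Submodule.smul_mem _ _ (one_mem_weightFil (by simp))⟩
  | add a b _ _ ha hb =>
    obtain ⟨m, ha⟩ := ha
    obtain ⟨n, hb⟩ := hb
    exact ⟨m + n, add_mem (mem_weightFil_of_le (by push_cast; omega) ha)
      (mem_weightFil_of_le (by push_cast; omega) hb)⟩
  | mul a b _ _ ha hb =>
    obtain ⟨m, ha⟩ := ha
    obtain ⟨n, hb⟩ := hb
    exact ⟨m + n, mem_weightFil_of_le (by push_cast; omega) (mul_mem_weightFil ha hb)⟩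

end Filtration

/-! ### The action of functionals -/

section Hit

variable {k C : Type*} [Field k] [Ring C] [HopfAlgebra k C]

/-- The map `a ⊗ b ↦ f(b) a`. -/
def contractRight (f : C →ₗ[k] k) : C ⊗[k] C →ₗ[k] C :=
  (TensorProduct.rid k C).toLinearMap ∘ₗ f.lTensor C

@[simp]
theorem contractRight_tmul (f : C →ₗ[k] k) (a b : C) :
    contractRight f (a ⊗ₜ[k] b) = f b • a := by
  simp [contractRight]

/-- The left comodule endomorphism `c ↦ f(c₂) c₁` given by a functional `f`. -/
def hit (f : C →ₗ[k] k) : C →ₗ[k] C :=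
  contractRight f ∘ₗ Coalgebra.comul

theorem hit_apply (f : C →ₗ[k] k) (c : C) : hit f c = contractRight f (Coalgebra.comul c) := rfl

@[simp]
theorem hit_one (f : C →ₗ[k] k) : hit f (1 : C) = f 1 • 1 := by
  simp [hit_apply, Algebra.TensorProduct.one_def]

theorem counit_hit (f : C →ₗ[k] k) (c : C) : Coalgebra.counit (R := k) (hit f c) = f c := by
  let R := Coalgebra.Repr.arbitrary k c
  rw [hit_apply, ← R.eq]
  have := congrArg f (Coalgebra.sum_counit_smul R)
  simpa [mul_comm] using this

/-- Coassociativity. Since `f ∘ₗ hit g` is the convolution product of `f` and `g`, this says that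
`hit` turns convolution into composition. -/
theorem hit_comp_hit (f g : C →ₗ[k] k) (c : C) : hit (f ∘ₗ hit g) c = hit f (hit g c) := by
  have h := congrArg (contractRight f ∘ₗ (contractRight g).lTensor C)
    (Coalgebra.coassoc_apply (R := k) c)
  have h1 : ∀ w : C ⊗[k] C, contractRight (f ∘ₗ hit g) w =
      (contractRight f ∘ₗ (contractRight g).lTensor C) (Coalgebra.comul.lTensor C w) := by
    intro w
    induction w with
    | zero => simp
    | add a b ha hb => simp only [map_add, ha, hb]
    | tmul a b => simp [hit_apply]
  have h2 : ∀ w : C ⊗[k] C, hit f (contractRight g w) =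
      (contractRight f ∘ₗ (contractRight g).lTensor C)
        (TensorProduct.assoc k C C C (Coalgebra.comul.rTensor C w)) := by
    intro w
    induction w with
    | zero => simp
    | add a b ha hb => simp only [map_add, ha, hb]
    | tmul a b =>
      simp only [contractRight_tmul, map_smul, hit_apply, LinearMap.rTensor_tmul]
      generalize Coalgebra.comul (R := k) a = v
      induction v with
      | zero => simp
      | add a b ha hb => simp only [map_add, ha, hb, smul_add, TensorProduct.add_tmul]
      | tmul c d => simp
  rw [hit_apply, h1, ← h, ← h2]
  rfl

/-- Expand `Δ(xc) = (x ⊗ 1 + 1 ⊗ x) Δ(c)`: the factor `1 ⊗ x` is absorbed into the functional. -/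
theorem hit_mul_of_primitive {x : C} (hx : IsPrimitiveElt k x) (f : C →ₗ[k] k) (c : C) :
    hit f (x * c) = x * hit f c + hit (f ∘ₗ LinearMap.mulLeft k x) c := by
  rw [hit_apply, Bialgebra.comul_mul, hit_apply, hit_apply, hx]
  generalize Coalgebra.comul (R := k) c = w
  induction w with
  | zero => simp
  | add a b ha hb => simp only [map_add, mul_add, ha, hb]; abel
  | tmul a b => simp [add_mul]

theorem hit_z_mul {x y z : C} (hz : Coalgebra.comul (R := k) z =
      1 ⊗ₜ[k] z + x ⊗ₜ[k] y - y ⊗ₜ[k] x + z ⊗ₜ[k] 1) (f : C →ₗ[k] k) (c : C) :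
    hit f (z * c) = z * hit f c + hit (f ∘ₗ LinearMap.mulLeft k z) c
      + x * hit (f ∘ₗ LinearMap.mulLeft k y) c - y * hit (f ∘ₗ LinearMap.mulLeft k x) c := by
  simp only [hit_apply]
  rw [Bialgebra.comul_mul, hz]
  generalize Coalgebra.comul (R := k) c = w
  induction w with
  | zero => simp
  | add a b ha hb => simp only [map_add, mul_add, ha, hb]; abel
  | tmul a b => simp [add_mul, sub_mul]; abel

theorem counit_eq_zero_of_primitive {x : C} (hx : IsPrimitiveElt k x) :
    Coalgebra.counit (R := k) x = 0 := by
  have h := counit_hit (Coalgebra.counit (R := k) (A := C)) x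
  rw [hit_apply, hx] at h
  simpa using h

theorem hit_primitive {x : C} (hx : IsPrimitiveElt k x) (f : C →ₗ[k] k) :
    hit f x = f 1 • x + f x • 1 := by
  rw [hit_apply, hx]
  simp

end Hit

/-! ### Thin triples -/

section Triple

variable (k : Type*) {C : Type*} [Field k] [Ring C] [HopfAlgebra k C]

/-- Two primitive generators `x`, `y` and a third generator `z` with
`δ(z) = x ⊗ y - y ⊗ x`, which commute up to terms of lower weight, together with functionals
`ξ` and `η` dual to `x` and `y`. -/
structure ThinTriple (x y z : C) (ξ η : C →ₗ[k] k) : Prop where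
  primitive_x : IsPrimitiveElt k x
  primitive_y : IsPrimitiveElt k y
  comul_z : Coalgebra.comul (R := k) z = 1 ⊗ₜ[k] z + x ⊗ₜ[k] y - y ⊗ₜ[k] x + z ⊗ₜ[k] 1
  comm_xy : x * y - y * x ∈ weightFil k x y z 1
  comm_xz : x * z - z * x ∈ weightFil k x y z 2
  comm_yz : y * z - z * y ∈ weightFil k x y z 2
  adjoin_eq_top : Algebra.adjoin k {x, y, z} = ⊤
  ξ_one : ξ 1 = 0
  ξ_x : ξ x = 1
  ξ_y : ξ y = 0
  η_one : η 1 = 0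
  η_x : η x = 0
  η_y : η y = 1

variable {k} {x y z : C} {ξ η : C →ₗ[k] k}

namespace ThinTriple

variable (T : ThinTriple k x y z ξ η)
include T

/-- A functional vanishing on the words of weight at most `m` lowers weights by `m + 1`. -/
theorem hit_mem {n : ℤ} {c : C} (hc : c ∈ weightFil k x y z n) (m : ℤ) (f : C →ₗ[k] k)
    (hf : ∀ b ∈ weightFil k x y z m, f b = 0) : hit f c ∈ weightFil k x y z (n - m - 1) := by
  -- The induction must run over all `m` and `f` at once, because prefixing a letter replaces `f` by
  -- `f ∘ₗ LinearMap.mulLeft k x` (or `y`, `z`), which vanishes only in smaller weights.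
  let P : ℤ → Submodule k C := fun n => ⨅ (m : ℤ) (f : C →ₗ[k] k)
    (_ : ∀ b ∈ weightFil k x y z m, f b = 0), (weightFil k x y z (n - m - 1)).comap (hit f)
  have hP : ∀ (n : ℤ) (c : C), c ∈ P n ↔ ∀ (m : ℤ) (f : C →ₗ[k] k),
      (∀ b ∈ weightFil k x y z m, f b = 0) → hit f c ∈ weightFil k x y z (n - m - 1) := by
    intro n c
    simp [P, Submodule.mem_iInf]
  suffices H : weightFil k x y z n ≤ P n from (hP n c).1 (H hc) m f hf
  have hx : ∀ {m : ℤ} {f : C →ₗ[k] k}, (∀ b ∈ weightFil k x y z m, f b = 0) →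
      ∀ b ∈ weightFil k x y z (m - 1), (f ∘ₗ LinearMap.mulLeft k x) b = 0 :=
    fun hf b hb => hf _ (mem_weightFil_of_le (by omega) (x_mul_mem hb))
  have hy : ∀ {m : ℤ} {f : C →ₗ[k] k}, (∀ b ∈ weightFil k x y z m, f b = 0) →
      ∀ b ∈ weightFil k x y z (m - 1), (f ∘ₗ LinearMap.mulLeft k y) b = 0 :=
    fun hf b hb => hf _ (mem_weightFil_of_le (by omega) (y_mul_mem hb))
  have hz : ∀ {m : ℤ} {f : C →ₗ[k] k}, (∀ b ∈ weightFil k x y z m, f b = 0) →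
      ∀ b ∈ weightFil k x y z (m - 2), (f ∘ₗ LinearMap.mulLeft k z) b = 0 :=
    fun hf b hb => hf _ (mem_weightFil_of_le (by omega) (z_mul_mem hb))
  refine weightFil_induction ?_ ?_ ?_ ?_ ?_ n
  · rw [hP]
    intro m f hf
    rw [hit_one]
    rcases lt_or_ge m 0 with hm | hm
    · exact Submodule.smul_mem _ _ (one_mem_weightFil (by omega))
    · rw [hf 1 (one_mem_weightFil hm), zero_smul]
      exact zero_mem _
  · intro i j c hij _ hc
    rw [hP] at hc ⊢
    exact fun m f hf => mem_weightFil_of_le (by omega) (hc m f hf)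
  · intro i c _ hc
    rw [hP] at hc ⊢
    intro m f hf
    rw [hit_mul_of_primitive T.primitive_x]
    exact add_mem (mem_weightFil_of_le (by omega) (x_mul_mem (hc m f hf)))
      (mem_weightFil_of_le (by omega) (hc _ _ (hx hf)))
  · intro i c _ hc
    rw [hP] at hc ⊢
    intro m f hf
    rw [hit_mul_of_primitive T.primitive_y]
    exact add_mem (mem_weightFil_of_le (by omega) (y_mul_mem (hc m f hf)))
      (mem_weightFil_of_le (by omega) (hc _ _ (hy hf)))
  · intro i c _ hc
    rw [hP] at hc ⊢
    intro m f hf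
    rw [hit_z_mul T.comul_z]
    exact sub_mem (add_mem (add_mem
      (mem_weightFil_of_le (by omega) (z_mul_mem (hc m f hf)))
      (mem_weightFil_of_le (by omega) (hc _ _ (hz hf))))
      (mem_weightFil_of_le (by omega) (x_mul_mem (hc _ _ (hy hf)))))
      (mem_weightFil_of_le (by omega) (y_mul_mem (hc _ _ (hx hf))))

theorem hit_mem_self {n : ℤ} {c : C} (hc : c ∈ weightFil k x y z n) (f : C →ₗ[k] k) :
    hit f c ∈ weightFil k x y z n :=
  mem_weightFil_of_le (by omega) (T.hit_mem hc (-1) f fun b hb => by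
    rw [eq_zero_of_mem_weightFil (by omega) hb, map_zero])

theorem hit_mem_sub_one {n : ℤ} {c : C} (hc : c ∈ weightFil k x y z n) {f : C →ₗ[k] k}
    (hf : f 1 = 0) : hit f c ∈ weightFil k x y z (n - 1) :=
  mem_weightFil_of_le (by omega) (T.hit_mem hc 0 f fun b hb => by
    obtain ⟨a, rfl⟩ := mem_weightFil_zero hb
    rw [map_smul, hf, smul_zero])

theorem hit_ξ_mem {n : ℤ} {c : C} (hc : c ∈ weightFil k x y z n) :
    hit ξ c ∈ weightFil k x y z (n - 1) :=
  T.hit_mem_sub_one hc T.ξ_one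

theorem hit_η_mem {n : ℤ} {c : C} (hc : c ∈ weightFil k x y z n) :
    hit η c ∈ weightFil k x y z (n - 1) :=
  T.hit_mem_sub_one hc T.η_one

/-- A functional taking the value `r` at `1` acts as `r`, up to terms of lower weight. -/
theorem hit_sub_smul_mem {n : ℤ} {c : C} (hc : c ∈ weightFil k x y z n) {f : C →ₗ[k] k} :
    hit f c - f 1 • c ∈ weightFil k x y z (n - 1) := by
  -- The counit acts as the identity, so subtracting `f 1` times it leaves a functional that
  -- vanishes at 1.
  have h : hit f c - f 1 • c = hit (f - f 1 • Coalgebra.counit (R := k) (A := C)) c := by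
    have h1 : hit (Coalgebra.counit (R := k) (A := C)) c = c := by
      simp [hit, contractRight]
    have h2 : ∀ w : C ⊗[k] C, contractRight (f - f 1 • Coalgebra.counit (R := k) (A := C)) w =
        contractRight f w - f 1 • contractRight (Coalgebra.counit (R := k) (A := C)) w := by
      intro w
      induction w with
      | zero => simp
      | add a b ha hb => simp only [map_add, ha, hb, smul_add]; abel
      | tmul a b => simp [sub_smul, mul_smul]
    rw [hit_apply (f - _), h2, ← hit_apply, ← hit_apply, h1]
  rw [h]
  exact T.hit_mem_sub_one hc (by simp)

theorem hit_ξ_x_mul {n : ℤ} {c : C} (hc : c ∈ weightFil k x y z n) :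
    hit ξ (x * c) - x * hit ξ c - c ∈ weightFil k x y z (n - 1) := by
  have h := T.hit_sub_smul_mem hc (f := ξ ∘ₗ LinearMap.mulLeft k x)
  rw [hit_mul_of_primitive T.primitive_x]
  simpa [T.ξ_x] using h

theorem hit_η_x_mul {n : ℤ} {c : C} (hc : c ∈ weightFil k x y z n) :
    hit η (x * c) - x * hit η c ∈ weightFil k x y z (n - 1) := by
  have h := T.hit_sub_smul_mem hc (f := η ∘ₗ LinearMap.mulLeft k x)
  rw [hit_mul_of_primitive T.primitive_x]
  simpa [T.η_x] using h

theorem hit_ξ_y_mul {n : ℤ} {c : C} (hc : c ∈ weightFil k x y z n) :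
    hit ξ (y * c) - y * hit ξ c ∈ weightFil k x y z (n - 1) := by
  have h := T.hit_sub_smul_mem hc (f := ξ ∘ₗ LinearMap.mulLeft k y)
  rw [hit_mul_of_primitive T.primitive_y]
  simpa [T.ξ_y] using h

theorem hit_η_y_mul {n : ℤ} {c : C} (hc : c ∈ weightFil k x y z n) :
    hit η (y * c) - y * hit η c - c ∈ weightFil k x y z (n - 1) := by
  have h := T.hit_sub_smul_mem hc (f := η ∘ₗ LinearMap.mulLeft k y)
  rw [hit_mul_of_primitive T.primitive_y]
  simpa [T.η_y] using h

/-- The term `- y ⊗ x` of `Δ(z)` is responsible for `- y * c`: to leading order `ξ` is `∂_x - y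
∂_z`. The partner lemma for `η` gets `+ x * c` from `x ⊗ y`. -/
theorem hit_ξ_z_mul {n : ℤ} {c : C} (hc : c ∈ weightFil k x y z n) :
    hit ξ (z * c) - z * hit ξ c + y * c ∈ weightFil k x y z n := by
  have h1 := y_mul_mem (T.hit_sub_smul_mem hc (f := ξ ∘ₗ LinearMap.mulLeft k x))
  have h2 := x_mul_mem (T.hit_sub_smul_mem hc (f := ξ ∘ₗ LinearMap.mulLeft k y))
  have h3 := T.hit_mem_self hc (ξ ∘ₗ LinearMap.mulLeft k z)
  simp only [LinearMap.comp_apply, LinearMap.mulLeft_apply, mul_one, T.ξ_x, T.ξ_y, one_smul,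
    zero_smul, sub_zero, sub_add_cancel, mul_sub] at h1 h2
  rw [hit_z_mul T.comul_z]
  convert sub_mem (add_mem h2 h3) h1 using 1
  abel

theorem hit_η_z_mul {n : ℤ} {c : C} (hc : c ∈ weightFil k x y z n) :
    hit η (z * c) - z * hit η c - x * c ∈ weightFil k x y z n := by
  have h1 := y_mul_mem (T.hit_sub_smul_mem hc (f := η ∘ₗ LinearMap.mulLeft k x))
  have h2 := x_mul_mem (T.hit_sub_smul_mem hc (f := η ∘ₗ LinearMap.mulLeft k y))
  have h3 := T.hit_mem_self hc (η ∘ₗ LinearMap.mulLeft k z)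
  simp only [LinearMap.comp_apply, LinearMap.mulLeft_apply, mul_one, T.η_x, T.η_y, one_smul,
    zero_smul, sub_zero, sub_add_cancel, mul_sub] at h1 h2
  rw [hit_z_mul T.comul_z]
  convert sub_mem (add_mem h2 h3) h1 using 1
  abel

end ThinTriple
end Triple

/-! ### The Heisenberg relations and Euler's identity. -/

section Commutator

variable {k : Type*} {C : Type*} [Field k] [Ring C] [HopfAlgebra k C]

/-- The commutator of the actions of two functionals. -/
def hitComm (f g : C →ₗ[k] k) : C →ₗ[k] C :=
  hit f ∘ₗ hit g - hit g ∘ₗ hit f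

theorem hitComm_apply (f g : C →ₗ[k] k) (c : C) :
    hitComm f g c = hit f (hit g c) - hit g (hit f c) := rfl

variable {x y z : C} {ξ η : C →ₗ[k] k}

namespace ThinTriple

variable (T : ThinTriple k x y z ξ η)
include T

theorem hitComm_mem {n : ℤ} {c : C} (hc : c ∈ weightFil k x y z n) :
    hitComm ξ η c ∈ weightFil k x y z (n - 2) :=
  mem_weightFil_of_le (by omega)
    (sub_mem (T.hit_ξ_mem (T.hit_η_mem hc)) (T.hit_η_mem (T.hit_ξ_mem hc)))

theorem hitComm_x_mul {n : ℤ} {c : C} (hc : c ∈ weightFil k x y z n) :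
    hitComm ξ η (x * c) - x * hitComm ξ η c ∈ weightFil k x y z (n - 2) := by
  have h1 := T.hit_ξ_mem (T.hit_η_x_mul hc)
  have h2 := T.hit_ξ_x_mul (T.hit_η_mem hc)
  have h3 := T.hit_η_mem (T.hit_ξ_x_mul hc)
  have h4 := T.hit_η_x_mul (T.hit_ξ_mem hc)
  refine mem_weightFil_of_le (m := n - 1 - 1) (by omega) ?_
  convert sub_mem (add_mem h1 h2) (add_mem h3 h4) using 1
  simp only [hitComm_apply, map_sub, mul_sub]
  abel

theorem hitComm_y_mul {n : ℤ} {c : C} (hc : c ∈ weightFil k x y z n) :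
    hitComm ξ η (y * c) - y * hitComm ξ η c ∈ weightFil k x y z (n - 2) := by
  have h1 := T.hit_ξ_mem (T.hit_η_y_mul hc)
  have h2 := T.hit_ξ_y_mul (T.hit_η_mem hc)
  have h3 := T.hit_η_mem (T.hit_ξ_y_mul hc)
  have h4 := T.hit_η_y_mul (T.hit_ξ_mem hc)
  refine mem_weightFil_of_le (m := n - 1 - 1) (by omega) ?_
  convert sub_mem (add_mem h1 h2) (add_mem h3 h4) using 1
  simp only [hitComm_apply, map_sub, mul_sub]
  abel

/-- The 2 is `ξ(x) + η(y)`, from the terms `x * c` and `- y * c` in the actions of `η` and `ξ` on `z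
* c`. -/
theorem hitComm_z_mul {n : ℤ} {c : C} (hc : c ∈ weightFil k x y z n) :
    hitComm ξ η (z * c) - z * hitComm ξ η c - (2 : k) • c ∈ weightFil k x y z (n - 1) := by
  have h1 := T.hit_ξ_mem (T.hit_η_z_mul hc)
  have h2 := T.hit_ξ_z_mul (T.hit_η_mem hc)
  have h3 := T.hit_ξ_x_mul hc
  have h4 := T.hit_η_mem (T.hit_ξ_z_mul hc)
  have h5 := T.hit_η_z_mul (T.hit_ξ_mem hc)
  have h6 := T.hit_η_y_mul hc
  convert add_mem (sub_mem (add_mem (add_mem h1 h2) h3) (add_mem h4 h5)) h6 using 1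
  simp only [hitComm_apply, map_sub, map_add, mul_sub, two_smul]
  abel

/-- The action of `ξ` commutes with the commutator of the actions of `ξ` and `η`, up to terms
of lower weight. -/
theorem hit_ξ_hitComm_mem {n : ℤ} {c : C} (hc : c ∈ weightFil k x y z n) :
    hit ξ (hitComm ξ η c) - hitComm ξ η (hit ξ c) ∈ weightFil k x y z (n - 4) := by
  -- Counting weights gives only `n - 3`; one more is gained because the leading terms produced by
  -- each letter cancel.
  refine weightFil_induction (P := fun n => (weightFil k x y z (n - 4)).comap
    (hit ξ ∘ₗ hitComm ξ η - hitComm ξ η ∘ₗ hit ξ)) ?_ ?_ ?_ ?_ ?_ n hc <;>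
    simp only [Submodule.mem_comap, LinearMap.sub_apply, LinearMap.comp_apply]
  · simp [hitComm_apply, T.ξ_one, T.η_one]
  · exact fun h _ hc => mem_weightFil_of_le (by omega) hc
  · intro n c hc ih
    have h1 := T.hit_ξ_mem (T.hitComm_x_mul hc)
    have h2 := T.hit_ξ_x_mul (T.hitComm_mem hc)
    have h3 := T.hitComm_mem (T.hit_ξ_x_mul hc)
    have h4 := T.hitComm_x_mul (T.hit_ξ_mem hc)
    have h5 := x_mul_mem ih
    refine mem_weightFil_of_le (m := n - 3) (by omega) ?_
    ring_nf at h1 h2 h3 h4 h5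
    convert add_mem h5 (sub_mem (add_mem h1 h2) (add_mem h3 h4)) using 1
    · ring_nf
    · simp only [map_sub, mul_sub]
      abel
  · intro n c hc ih
    have h1 := T.hit_ξ_mem (T.hitComm_y_mul hc)
    have h2 := T.hit_ξ_y_mul (T.hitComm_mem hc)
    have h3 := T.hitComm_mem (T.hit_ξ_y_mul hc)
    have h4 := T.hitComm_y_mul (T.hit_ξ_mem hc)
    have h5 := y_mul_mem ih
    refine mem_weightFil_of_le (m := n - 3) (by omega) ?_
    ring_nf at h1 h2 h3 h4 h5
    convert add_mem h5 (sub_mem (add_mem h1 h2) (add_mem h3 h4)) using 1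
    · ring_nf
    · simp only [map_sub, mul_sub]
      abel
  · intro n c hc ih
    have h1 := T.hit_ξ_mem (T.hitComm_z_mul hc)
    have h2 := T.hit_ξ_z_mul (T.hitComm_mem hc)
    have h3 := T.hitComm_mem (T.hit_ξ_z_mul hc)
    have h4 := T.hitComm_z_mul (T.hit_ξ_mem hc)
    have h5 := z_mul_mem ih
    have h6 := T.hitComm_y_mul hc
    refine mem_weightFil_of_le (m := n - 2) (by omega) ?_
    ring_nf at h1 h2 h3 h4 h5 h6
    convert add_mem (add_mem h5 (sub_mem (add_mem h1 h2) (add_mem h3 h4))) h6 using 1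
    · ring_nf
    · simp only [map_sub, map_add, mul_sub, two_smul]
      abel

theorem hit_η_hitComm_mem {n : ℤ} {c : C} (hc : c ∈ weightFil k x y z n) :
    hit η (hitComm ξ η c) - hitComm ξ η (hit η c) ∈ weightFil k x y z (n - 4) := by
  refine weightFil_induction (P := fun n => (weightFil k x y z (n - 4)).comap
    (hit η ∘ₗ hitComm ξ η - hitComm ξ η ∘ₗ hit η)) ?_ ?_ ?_ ?_ ?_ n hc <;>
    simp only [Submodule.mem_comap, LinearMap.sub_apply, LinearMap.comp_apply]
  · simp [hitComm_apply, T.ξ_one, T.η_one]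
  · exact fun h _ hc => mem_weightFil_of_le (by omega) hc
  · intro n c hc ih
    have h1 := T.hit_η_mem (T.hitComm_x_mul hc)
    have h2 := T.hit_η_x_mul (T.hitComm_mem hc)
    have h3 := T.hitComm_mem (T.hit_η_x_mul hc)
    have h4 := T.hitComm_x_mul (T.hit_η_mem hc)
    have h5 := x_mul_mem ih
    refine mem_weightFil_of_le (m := n - 3) (by omega) ?_
    ring_nf at h1 h2 h3 h4 h5
    convert add_mem h5 (sub_mem (add_mem h1 h2) (add_mem h3 h4)) using 1
    · ring_nf
    · simp only [map_sub, mul_sub]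
      abel
  · intro n c hc ih
    have h1 := T.hit_η_mem (T.hitComm_y_mul hc)
    have h2 := T.hit_η_y_mul (T.hitComm_mem hc)
    have h3 := T.hitComm_mem (T.hit_η_y_mul hc)
    have h4 := T.hitComm_y_mul (T.hit_η_mem hc)
    have h5 := y_mul_mem ih
    refine mem_weightFil_of_le (m := n - 3) (by omega) ?_
    ring_nf at h1 h2 h3 h4 h5
    convert add_mem h5 (sub_mem (add_mem h1 h2) (add_mem h3 h4)) using 1
    · ring_nf
    · simp only [map_sub, mul_sub]
      abel
  · intro n c hc ih
    have h1 := T.hit_η_mem (T.hitComm_z_mul hc)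
    have h2 := T.hit_η_z_mul (T.hitComm_mem hc)
    have h3 := T.hitComm_mem (T.hit_η_z_mul hc)
    have h4 := T.hitComm_z_mul (T.hit_η_mem hc)
    have h5 := z_mul_mem ih
    have h6 := T.hitComm_x_mul hc
    refine mem_weightFil_of_le (m := n - 2) (by omega) ?_
    ring_nf at h1 h2 h3 h4 h5 h6
    convert sub_mem (add_mem h5 (sub_mem (add_mem h1 h2) (add_mem h3 h4))) h6 using 1
    · ring_nf
    · simp only [map_sub, map_add, mul_sub, two_smul]
      abel

/-- Euler's identity: `x ξ + y η + z [ξ, η]` acts as `n` on words of weight `n`, up to terms of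
lower weight. -/
theorem euler {n : ℤ} {c : C} (hc : c ∈ weightFil k x y z n) :
    x * hit ξ c + y * hit η c + z * hitComm ξ η c - (n : k) • c ∈
      weightFil k x y z (n - 1) := by
  refine weightFil_induction (P := fun n : ℤ => (weightFil k x y z (n - 1)).comap
    (LinearMap.mulLeft k x ∘ₗ hit ξ + LinearMap.mulLeft k y ∘ₗ hit η
      + LinearMap.mulLeft k z ∘ₗ hitComm ξ η - (n : k) • LinearMap.id)) ?_ ?_ ?_ ?_ ?_ n hc <;>
    simp only [Submodule.mem_comap, LinearMap.sub_apply, LinearMap.comp_apply,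
      LinearMap.add_apply, LinearMap.mulLeft_apply, LinearMap.smul_apply, LinearMap.id_apply]
  · simp [hitComm_apply, T.ξ_one, T.η_one]
  · intro m n c h hc ih
    rcases h.eq_or_lt with rfl | h
    · exact ih
    · refine sub_mem (add_mem (add_mem ?_ ?_) ?_) (Submodule.smul_mem _ _ ?_)
      · exact mem_weightFil_of_le (by omega) (x_mul_mem (T.hit_ξ_mem hc))
      · exact mem_weightFil_of_le (by omega) (y_mul_mem (T.hit_η_mem hc))
      · exact mem_weightFil_of_le (by omega) (z_mul_mem (T.hitComm_mem hc))
      · exact mem_weightFil_of_le (by omega) hc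
  · intro n c hc ih
    have h0 := x_mul_mem ih
    have h1 := x_mul_mem (T.hit_ξ_x_mul hc)
    have h2 := y_mul_mem (T.hit_η_x_mul hc)
    have h3 := z_mul_mem (T.hitComm_x_mul hc)
    -- Commutativity up to lower weight is what lets the new letter be moved to the front past the
    -- coefficients `x`, `y`, `z` of the Euler operator.
    have h4 := mul_mem_weightFil T.comm_xy (T.hit_η_mem hc)
    have h5 := mul_mem_weightFil T.comm_xz (T.hitComm_mem hc)
    refine mem_weightFil_of_le (m := n) (by omega) ?_
    ring_nf at h0 h1 h2 h3 h4 h5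
    convert sub_mem (add_mem h0 (add_mem (add_mem h1 h2) h3)) (add_mem h4 h5) using 1
    simp only [mul_sub, mul_add, sub_mul, mul_assoc, mul_smul_comm, Int.cast_add, Int.cast_one,
      add_smul, one_smul]
    abel
  · intro n c hc ih
    have h0 := y_mul_mem ih
    have h1 := x_mul_mem (T.hit_ξ_y_mul hc)
    have h2 := y_mul_mem (T.hit_η_y_mul hc)
    have h3 := z_mul_mem (T.hitComm_y_mul hc)
    have h4 := mul_mem_weightFil T.comm_xy (T.hit_ξ_mem hc)
    have h5 := mul_mem_weightFil T.comm_yz (T.hitComm_mem hc)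
    refine mem_weightFil_of_le (m := n) (by omega) ?_
    ring_nf at h0 h1 h2 h3 h4 h5
    convert sub_mem (add_mem (add_mem h0 (add_mem (add_mem h1 h2) h3)) h4) h5 using 1
    simp only [mul_sub, mul_add, sub_mul, mul_assoc, mul_smul_comm, Int.cast_add, Int.cast_one,
      add_smul, one_smul]
    abel
  · intro n c hc ih
    have h0 := z_mul_mem ih
    have h1 := x_mul_mem (T.hit_ξ_z_mul hc)
    have h2 := y_mul_mem (T.hit_η_z_mul hc)
    have h3 := z_mul_mem (T.hitComm_z_mul hc)
    have h4 := mul_mem_weightFil T.comm_xz (T.hit_ξ_mem hc)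
    have h5 := mul_mem_weightFil T.comm_yz (T.hit_η_mem hc)
    have h6 := mul_mem_weightFil T.comm_xy hc
    refine mem_weightFil_of_le (m := n + 1) (by omega) ?_
    ring_nf at h0 h1 h2 h3 h4 h5 h6
    rw [add_comm n 1]
    convert sub_mem (add_mem (add_mem (add_mem h0 (add_mem (add_mem h1 h2) h3)) h4) h5) h6
      using 1
    simp only [mul_sub, mul_add, sub_mul, mul_assoc, mul_smul_comm, Int.cast_add, Int.cast_ofNat,
      add_smul, two_smul]
    abel

/-! ### Detecting the filtration and integrating, by dividing by the weight. -/

section CharZero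

variable [CharZero k]

/-- Under these hypotheses the three terms of the Euler operator drop in weight, so `n • c` does
too, and `n` is invertible. -/
theorem mem_of_hit_mem_sub_two {n : ℤ} (hn : 1 ≤ n) {c : C} (hc : c ∈ weightFil k x y z n)
    (hξ : hit ξ c ∈ weightFil k x y z (n - 2)) (hη : hit η c ∈ weightFil k x y z (n - 2)) :
    c ∈ weightFil k x y z (n - 1) := by
  have h1 := x_mul_mem hξ
  have h2 := y_mul_mem hη
  have h3 := z_mul_mem (sub_mem (T.hit_ξ_mem hη) (T.hit_η_mem hξ))
  have h4 := T.euler hc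
  rw [← hitComm_apply] at h3
  ring_nf at h1 h2 h3 h4
  have h5 := sub_mem (add_mem (add_mem h1 h2) h3) h4
  rw [sub_sub_cancel] at h5
  have hn' : (n : k) ≠ 0 := by exact_mod_cast (by omega : n ≠ 0)
  rw [← Submodule.smul_mem_iff _ hn']
  convert h5 using 1
  ring_nf

/-- The filtration is detected by the actions of `ξ` and `η`. -/
theorem mem_of_hit_mem {m : ℤ} (hm : 0 ≤ m) {c : C}
    (hξ : hit ξ c ∈ weightFil k x y z (m - 1)) (hη : hit η c ∈ weightFil k x y z (m - 1)) :
    c ∈ weightFil k x y z m := by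
  obtain ⟨n, hn⟩ := exists_mem_weightFil T.adjoin_eq_top c
  induction n with
  | zero => exact mem_weightFil_of_le (by simpa using hm) hn
  | succ n ih =>
    rcases le_or_gt ((n + 1 : ℕ) : ℤ) m with h | h
    · exact mem_weightFil_of_le h hn
    · refine ih ?_
      -- Start from any weight that contains `c` and descend one step at a time until `m` is
      -- reached.
      have := T.mem_of_hit_mem_sub_two (by push_cast; omega) hn
        (mem_weightFil_of_le (by omega) hξ) (mem_weightFil_of_le (by omega) hη)
      exact mem_weightFil_of_le (by push_cast; omega) this

/-- Linear duality: by `mem_of_hit_mem`, `h` vanishes on the kernel of `(ξ, η)` taken modulo weight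
`m - 1`, hence factors through that map. In the dual algebra, `ξ` and `η` thus generate the
functionals that vanish in low weight. -/
theorem exists_factorization {m : ℤ} (hm : 0 ≤ m) (h : C →ₗ[k] k)
    (hh : ∀ c ∈ weightFil k x y z m, h c = 0) :
    ∃ f g : C →ₗ[k] k, (∀ c ∈ weightFil k x y z (m - 1), f c = 0) ∧
      (∀ c ∈ weightFil k x y z (m - 1), g c = 0) ∧ h = f ∘ₗ hit ξ + g ∘ₗ hit η := by
  let F := weightFil k x y z (m - 1)
  let φ : C →ₗ[k] (C ⧸ F) × (C ⧸ F) :=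
    LinearMap.prod (F.mkQ ∘ₗ hit ξ) (F.mkQ ∘ₗ hit η)
  have hmem : h ∈ LinearMap.range φ.dualMap := by
    rw [LinearMap.range_dualMap_eq_dualAnnihilator_ker, Submodule.mem_dualAnnihilator]
    intro c hc
    simp only [φ, LinearMap.mem_ker, LinearMap.prod_apply, Function.prod_apply,
      LinearMap.comp_apply, Prod.mk_eq_zero, Submodule.mkQ_apply,
      Submodule.Quotient.mk_eq_zero] at hc
    exact hh c (T.mem_of_hit_mem hm hc.1 hc.2)
  obtain ⟨ψ, hψ⟩ := hmem
  refine ⟨ψ ∘ₗ LinearMap.inl k _ _ ∘ₗ F.mkQ, ψ ∘ₗ LinearMap.inr k _ _ ∘ₗ F.mkQ, ?_, ?_, ?_⟩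
  · intro c hc
    simp [(Submodule.Quotient.mk_eq_zero F).2 hc, ← Prod.zero_eq_mk]
  · intro c hc
    simp [(Submodule.Quotient.mk_eq_zero F).2 hc, ← Prod.zero_eq_mk]
  · ext c
    rw [← hψ]
    simp [φ, ← map_add]

/-- Solving `ξ c = α`, `η c = β` up to terms of lower weight. -/
theorem exists_hit_sub_mem {n : ℤ} (hn : n ≠ 0) {α β : C}
    (hα : α ∈ weightFil k x y z (n - 1)) (hβ : β ∈ weightFil k x y z (n - 1))
    (h₁ : hit ξ (hit ξ β - hit η α) - hitComm ξ η α ∈ weightFil k x y z (n - 4))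
    (h₂ : hit η (hit ξ β - hit η α) - hitComm ξ η β ∈ weightFil k x y z (n - 4)) :
    ∃ c ∈ weightFil k x y z n, hit ξ c - α ∈ weightFil k x y z (n - 2) ∧
      hit η c - β ∈ weightFil k x y z (n - 2) := by
  have hγ : hit ξ β - hit η α ∈ weightFil k x y z (n - 1 - 1) :=
    sub_mem (T.hit_ξ_mem hβ) (T.hit_η_mem hα)
  set γ := hit ξ β - hit η α with hγ_def
  have hn' : (n : k) ≠ 0 := by exact_mod_cast hn
  -- Euler's identity read backwards: a solution would satisfy `[ξ,η] c = ξβ - ηα = γ`, hence `n c =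
  -- xα + yβ + zγ` to leading order.
  refine ⟨(n : k)⁻¹ • (x * α + y * β + z * γ), Submodule.smul_mem _ _ (add_mem (add_mem ?_ ?_) ?_),
    ?_, ?_⟩
  · exact mem_weightFil_of_le (by omega) (x_mul_mem hα)
  · exact mem_weightFil_of_le (by omega) (y_mul_mem hβ)
  · exact mem_weightFil_of_le (by omega) (z_mul_mem hγ)
  · rw [← Submodule.smul_mem_iff _ hn', smul_sub, map_smul, smul_inv_smul₀ hn']
    have e1 := T.hit_ξ_x_mul hα
    have e2 := T.hit_ξ_y_mul hβ
    have e3 := T.hit_ξ_z_mul hγ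
    have e4 := T.euler hα
    have e5 := z_mul_mem h₁
    ring_nf at e1 e2 e3 e4 e5
    have e : (-2 + n) = n - 2 := by ring
    rw [e] at e1 e2 e3 e4 e5
    convert add_mem (add_mem (add_mem (add_mem e1 e2) e3) e4) e5 using 1
    simp only [map_add, mul_sub, hγ_def, Int.cast_add, Int.cast_neg, Int.cast_one, add_smul,
      neg_smul, one_smul]
    abel
  · rw [← Submodule.smul_mem_iff _ hn', smul_sub, map_smul, smul_inv_smul₀ hn']
    have e1 := T.hit_η_x_mul hα
    have e2 := T.hit_η_y_mul hβ
    have e3 := T.hit_η_z_mul hγ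
    have e4 := T.euler hβ
    have e5 := z_mul_mem h₂
    ring_nf at e1 e2 e3 e4 e5
    have e : (-2 + n) = n - 2 := by ring
    rw [e] at e1 e2 e3 e4 e5
    convert add_mem (add_mem (add_mem (add_mem e1 e2) e3) e4) e5 using 1
    simp only [map_add, mul_sub, hγ_def, Int.cast_add, Int.cast_neg, Int.cast_one, add_smul,
      neg_smul, one_smul]
    abel

end CharZero
end ThinTriple
end Commutator

/-! ### Slicing cochains of degree two and three by functionals. -/

section Slice

variable {k : Type*} {C : Type*} [Field k] [Ring C] [HopfAlgebra k C]

/-- The multiplication map `C⁺ ⊗ C⁺ → ΩC`, with image in degree two. -/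
def degreeTwo : augKer k C ⊗[k] augKer k C →ₗ[k] Cobar k C :=
  LinearMap.mul' k (Cobar k C) ∘ₗ TensorProduct.map (TensorAlgebra.ι k) (TensorAlgebra.ι k)

@[simp]
theorem degreeTwo_tmul (a b : augKer k C) :
    degreeTwo (a ⊗ₜ[k] b) = TensorAlgebra.ι k a * TensorAlgebra.ι k b := by
  simp [degreeTwo]

theorem exists_degreeTwo {w : Cobar k C} (hw : w ∈ cobarDegree k C 2) :
    ∃ ω, degreeTwo ω = w := by
  rw [cobarDegree, pow_two] at hw
  induction hw using Submodule.mul_induction_on' with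
  | mem_mul_mem a ha b hb =>
    obtain ⟨a, rfl⟩ := ha
    obtain ⟨b, rfl⟩ := hb
    exact ⟨a ⊗ₜ b, by simp⟩
  | add a _ b _ ha hb =>
    obtain ⟨a, rfl⟩ := ha
    obtain ⟨b, rfl⟩ := hb
    exact ⟨a + b, map_add _ _ _⟩

theorem exists_cobarOne {w : Cobar k C} (hw : w ∈ cobarDegree k C 1) :
    ∃ c : C, w = cobarOne k c := by
  rw [cobarDegree, pow_one] at hw
  obtain ⟨v, rfl⟩ := hw
  exact ⟨v, (cobarOne_of_mem k v.2).symm⟩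

theorem augProj_coe' (c : C) : (augProj k c : C) = c - Coalgebra.counit (R := k) c • 1 := by
  rw [augProj_coe, Algebra.algebraMap_eq_smul_one]

theorem cobarOne_one : cobarOne k (1 : C) = 0 := by
  have h : augProj k (1 : C) = 0 := by ext; simp [augProj_coe]
  rw [cobarOne, LinearMap.comp_apply, h, map_zero]

theorem map_augProj {f : C →ₗ[k] k} (hf : f 1 = 0) (c : C) : f (augProj k c : C) = f c := by
  simp [augProj_coe', hf]

/-- The algebra map by which `slice` is defined. -/
def sliceAux (f : C →ₗ[k] k) : Cobar k C →ₐ[k] Module.End k (k × k × C) :=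
  -- A strictly triangular action: starting from `(1, 0, 0)`, the right letter is evaluated by `f`
  -- and the left one is written into the last component. Only words of length two contribute there.
  TensorAlgebra.lift k <| LinearMap.mk₂ k
    (fun (a : augKer k C) (p : k × k × C) => (0, f a * p.1, p.2.1 • (a : C)))
    (fun a b p => by simp [add_mul]) (fun r a p => by simp [mul_assoc, smul_comm r])
    (fun a p q => by simp [mul_add, add_smul])
    (fun r a p => by simp [mul_left_comm, mul_smul])

/-- The linear map `ΩC → C` equal to `a ⊗ b ↦ f(b) a` in degree two. -/
def slice (f : C →ₗ[k] k) : Cobar k C →ₗ[k] C :=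
  LinearMap.snd k k C ∘ₗ LinearMap.snd k k (k × C) ∘ₗ
    LinearMap.applyₗ ((1, 0, 0) : k × k × C) ∘ₗ (sliceAux f).toLinearMap

theorem slice_ι_mul_ι (f : C →ₗ[k] k) (a b : augKer k C) :
    slice f (TensorAlgebra.ι k a * TensorAlgebra.ι k b) = f b • (a : C) := by
  simp [slice, sliceAux]

/-- The algebra map by which `slice₃` is defined. -/
def slice₃Aux (f g : C →ₗ[k] k) : Cobar k C →ₐ[k] Module.End k (k × k × k × C) :=
  TensorAlgebra.lift k <| LinearMap.mk₂ k
    (fun (a : augKer k C) (p : k × k × k × C) =>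
      (0, g a * p.1, f a * p.2.1, p.2.2.1 • (a : C)))
    (fun a b p => by simp [add_mul]) (fun r a p => by simp [mul_assoc, smul_comm r])
    (fun a p q => by simp [mul_add, add_smul])
    (fun r a p => by simp [mul_left_comm, mul_smul])

/-- The linear map `ΩC → C` equal to `a ⊗ b ⊗ c ↦ f(b) g(c) a` in degree three. -/
def slice₃ (f g : C →ₗ[k] k) : Cobar k C →ₗ[k] C :=
  LinearMap.snd k k C ∘ₗ LinearMap.snd k k (k × C) ∘ₗ LinearMap.snd k k (k × k × C) ∘ₗ
    LinearMap.applyₗ ((1, 0, 0, 0) : k × k × k × C) ∘ₗ (slice₃Aux f g).toLinearMap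

theorem slice₃_ι_mul_ι_mul_ι (f g : C →ₗ[k] k) (a b c : augKer k C) :
    slice₃ f g (TensorAlgebra.ι k a * TensorAlgebra.ι k b * TensorAlgebra.ι k c) =
      (f b * g c) • (a : C) := by
  simp [slice₃, slice₃Aux]

theorem slice_cobarOne_mul {f : C →ₗ[k] k} (hf : f 1 = 0) (a b : C) :
    slice f (cobarOne k a * cobarOne k b) = f b • (a - Coalgebra.counit (R := k) a • 1) := by
  rw [cobarOne, LinearMap.comp_apply, LinearMap.comp_apply, slice_ι_mul_ι, map_augProj hf,
    augProj_coe']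

theorem slice_degreeTwo (f : C →ₗ[k] k) (ω : augKer k C ⊗[k] augKer k C) :
    slice f (degreeTwo ω) =
      contractRight f (TensorProduct.map (augKer k C).subtype (augKer k C).subtype ω) := by
  induction ω with
  | zero => simp
  | add a b ha hb => simp only [map_add, ha, hb]
  | tmul a b => simp [slice_ι_mul_ι]

theorem contractRight_add (f g : C →ₗ[k] k) (w : C ⊗[k] C) :
    contractRight (f + g) w = contractRight f w + contractRight g w := by
  simp [contractRight, LinearMap.lTensor_add]

theorem contractRight_smul (r : k) (f : C →ₗ[k] k) (w : C ⊗[k] C) :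
    contractRight (r • f) w = r • contractRight f w := by
  simp [contractRight, LinearMap.lTensor_smul]

theorem slice_add (f g : C →ₗ[k] k) {w : Cobar k C} (hw : w ∈ cobarDegree k C 2) :
    slice (f + g) w = slice f w + slice g w := by
  obtain ⟨ω, rfl⟩ := exists_degreeTwo hw
  simp only [slice_degreeTwo, contractRight_add]

theorem slice_smul (r : k) (f : C →ₗ[k] k) {w : Cobar k C} (hw : w ∈ cobarDegree k C 2) :
    slice (r • f) w = r • slice f w := by
  obtain ⟨ω, rfl⟩ := exists_degreeTwo hw
  simp only [slice_degreeTwo, contractRight_smul]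

theorem slice_sub (f g : C →ₗ[k] k) {w : Cobar k C} (hw : w ∈ cobarDegree k C 2) :
    slice (f - g) w = slice f w - slice g w := by
  rw [sub_eq_add_neg, ← neg_one_smul k g, slice_add _ _ hw, slice_smul _ _ hw, neg_one_smul,
    sub_eq_add_neg]

theorem slice_counit {w : Cobar k C} (hw : w ∈ cobarDegree k C 2) :
    slice (Coalgebra.counit (R := k) (A := C)) w = 0 := by
  obtain ⟨ω, rfl⟩ := exists_degreeTwo hw
  clear hw
  induction ω with
  | zero => simp
  | add a b ha hb => rw [map_add, map_add, ha, hb, add_zero]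
  | tmul a b =>
    have : Coalgebra.counit (R := k) (b : C) = 0 := b.2
    rw [degreeTwo_tmul, slice_ι_mul_ι, this, zero_smul]

theorem counit_slice (f : C →ₗ[k] k) {w : Cobar k C} (hw : w ∈ cobarDegree k C 2) :
    Coalgebra.counit (R := k) (slice f w) = 0 := by
  obtain ⟨ω, rfl⟩ := exists_degreeTwo hw
  clear hw
  induction ω with
  | zero => simp
  | add a b ha hb => rw [map_add, map_add, map_add, ha, hb, add_zero]
  | tmul a b =>
    have : Coalgebra.counit (R := k) (a : C) = 0 := a.2
    rw [degreeTwo_tmul, slice_ι_mul_ι, map_smul, this, smul_zero]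

/-- The functionals separate the elements of degree two. -/
theorem eq_zero_of_slice_eq_zero {w : Cobar k C} (hw : w ∈ cobarDegree k C 2)
    (h : ∀ f : C →ₗ[k] k, slice f w = 0) : w = 0 := by
  classical
  obtain ⟨ω, rfl⟩ := exists_degreeTwo hw
  suffices hω : ω = 0 by rw [hω, map_zero]
  have hinj := TensorProduct.map_injective_of_flat_flat (augKer k C).subtype
    (augKer k C).subtype (augKer k C).injective_subtype (augKer k C).injective_subtype
  refine hinj ?_
  rw [map_zero]
  simp only [slice_degreeTwo] at h
  generalize TensorProduct.map (augKer k C).subtype (augKer k C).subtype ω = v at h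
  let b := Module.Basis.ofVectorSpace k C
  refine (TensorProduct.equivFinsuppOfBasisRight (M := C) b).injective ?_
  ext i
  have key : ∀ v : C ⊗[k] C, TensorProduct.equivFinsuppOfBasisRight (M := C) b v i =
      contractRight (b.coord i) v := by
    intro v
    induction v with
    | zero => simp
    | add a b ha hb => simp only [map_add, Finsupp.add_apply, ha, hb]
    | tmul c d => simp
  rw [key, h, map_zero, Finsupp.zero_apply]

theorem slice_cobarDifferential_cobarOne {f : C →ₗ[k] k} (hf : f 1 = 0) (c : C) :
    slice f (cobarDifferential k C (cobarOne k c)) = hit f c - f c • 1 := by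
  rw [cobarDifferential_cobarOne, ← counit_hit f c, hit_apply]
  generalize Coalgebra.comul (R := k) c = v
  induction v with
  | zero => simp
  | add a b ha hb => simp only [map_add, ha, hb, add_smul]; abel
  | tmul a b => simp [slice_cobarOne_mul hf, smul_sub, mul_smul]

/-- In `∂(a ⊗ b) = δ(a) ⊗ b - a ⊗ δ(b)`, the first part gives `hit f` of the slice along `g`, made
reduced by a constant, and the second gives the slice along the convolution product of `f` and `g`.
-/
theorem slice₃_cobarDifferential {f g : C →ₗ[k] k} (hf : f 1 = 0) (hg : g 1 = 0)
    {w : Cobar k C} (hw : w ∈ cobarDegree k C 2) :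
    slice₃ f g (cobarDifferential k C w) =
      hit f (slice g w) - f (slice g w) • 1 - slice (f ∘ₗ hit g) w := by
  have h1 : ∀ (a : augKer k C) (v : C ⊗[k] C), slice₃ f g
      ((LinearMap.mul' k (Cobar k C)).comp (TensorProduct.map (cobarOne k) (cobarOne k)) v *
        TensorAlgebra.ι k a) = g a • (contractRight f v -
          Coalgebra.counit (R := k) (contractRight f v) • 1) := by
    intro a v
    induction v with
    | zero => simp
    | add a b ha hb => simp only [map_add, add_mul, ha, hb, add_smul, smul_sub, smul_add]; abel
    | tmul b c =>
      simp only [LinearMap.comp_apply, TensorProduct.map_tmul, LinearMap.mul'_apply, cobarOne,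
        slice₃_ι_mul_ι_mul_ι, map_augProj hf, contractRight_tmul, map_smul, smul_eq_mul]
      rw [augProj_coe', mul_comm, smul_sub, smul_sub, mul_smul, mul_smul, mul_smul]
  have h2 : ∀ (a : augKer k C) (v : C ⊗[k] C), slice₃ f g (TensorAlgebra.ι k a *
      (LinearMap.mul' k (Cobar k C)).comp (TensorProduct.map (cobarOne k) (cobarOne k)) v) =
        f (contractRight g v) • (a : C) := by
    intro a v
    induction v with
    | zero => simp
    | add a b ha hb => simp only [map_add, mul_add, ha, hb, add_smul]
    | tmul b c =>
      simp only [LinearMap.comp_apply, TensorProduct.map_tmul, LinearMap.mul'_apply, cobarOne,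
        ← mul_assoc, slice₃_ι_mul_ι_mul_ι, map_augProj hf, map_augProj hg, contractRight_tmul,
        map_smul, smul_eq_mul]
      rw [mul_comm]
  obtain ⟨ω, rfl⟩ := exists_degreeTwo hw
  clear hw
  induction ω with
  | zero => simp
  | add a b ha hb => simp only [map_add, ha, hb, add_smul]; abel
  | tmul a b =>
    have hι : ∀ v : augKer k C, TensorAlgebra.ι k v = cobarOne k (v : C) :=
      fun v => (cobarOne_of_mem k v.2).symm
    have hb' : cobarDifferential k C (TensorAlgebra.ι k b) = _ :=
      (congrArg _ (hι b)).trans (cobarDifferential_cobarOne k (b : C))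
    have ha' : cobarDifferential k C (TensorAlgebra.ι k a) = _ :=
      (congrArg _ (hι a)).trans (cobarDifferential_cobarOne k (a : C))
    have hmem : TensorAlgebra.ι k a ∈ cobarDegree k C 1 := hι a ▸ cobarOne_mem k _
    rw [degreeTwo_tmul, cobarDifferential_mul k hmem, ha', hb', pow_one, neg_one_mul, neg_mul,
      map_add, map_neg, h1, h2, slice_ι_mul_ι, slice_ι_mul_ι, ← hit_apply, ← hit_apply,
      counit_hit, map_smul, map_smul, LinearMap.comp_apply, smul_eq_mul, smul_sub, mul_smul]
    abel

/-- This is the cocycle condition in terms of slices: those along `g` determine those along every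
product ending in `g`. -/
theorem slice_comp_hit {f g : C →ₗ[k] k} (hf : f 1 = 0) (hg : g 1 = 0)
    {w : Cobar k C} (hw : w ∈ cobarCocycles k C 2) :
    slice (f ∘ₗ hit g) w = hit f (slice g w) - f (slice g w) • 1 := by
  have h := slice₃_cobarDifferential hf hg hw.1
  rw [LinearMap.mem_ker.1 hw.2, map_zero] at h
  exact (sub_eq_zero.1 h.symm).symm

theorem exists_slice_comp_hit_comp_hit {f g h : C →ₗ[k] k} (hf : f 1 = 0) (hg : g 1 = 0)
    (hh : h 1 = 0) {w : Cobar k C} (hw : w ∈ cobarCocycles k C 2) :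
    ∃ s : k, slice (f ∘ₗ hit g ∘ₗ hit h) w = hit f (hit g (slice h w)) - s • 1 := by
  have e : f ∘ₗ hit g ∘ₗ hit h = f ∘ₗ hit (g ∘ₗ hit h) := by
    ext c
    simp [hit_comp_hit]
  rw [e, slice_comp_hit hf (by simp [hh]) hw, slice_comp_hit hg hh hw]
  refine ⟨f (hit g (slice h w) - g (slice h w) • 1), ?_⟩
  rw [map_sub (hit f), map_smul, hit_one, hf, zero_smul, smul_zero, sub_zero]

end Slice

/-! ### The cocycles `u` and `t`, obstructions, and descent on the weight. -/

section Cocycles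

variable {k : Type*} {C : Type*} [Field k] [Ring C] [HopfAlgebra k C]
variable {x y z : C} {ξ η : C →ₗ[k] k}

theorem cobarDifferential_mem_cobarCocycles {v : Cobar k C} (hv : v ∈ cobarDegree k C 1) :
    cobarDifferential k C v ∈ cobarCocycles k C 2 := by
  refine ⟨?_, cobarDifferential_sq k v⟩
  obtain ⟨c, rfl⟩ := exists_cobarOne hv
  rw [cobarDifferential_cobarOne]
  generalize Coalgebra.comul (R := k) c = v
  induction v with
  | zero => simp
  | add a b ha hb => rw [map_add]; exact add_mem ha hb
  | tmul a b => exact cobarOne_mul_cobarOne_mem k a b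

namespace ThinTriple

variable (T : ThinTriple k x y z ξ η)
include T

theorem counit_x : Coalgebra.counit (R := k) x = 0 := counit_eq_zero_of_primitive T.primitive_x

theorem counit_y : Coalgebra.counit (R := k) y = 0 := counit_eq_zero_of_primitive T.primitive_y

theorem counit_z : Coalgebra.counit (R := k) z = 0 := by
  have h := counit_hit (Coalgebra.counit (R := k) (A := C)) z
  rw [hit_apply, T.comul_z] at h
  simpa [T.counit_x, T.counit_y] using h

theorem comul_xy : Coalgebra.comul (R := k) (x * y) =
    (x * y) ⊗ₜ[k] 1 + x ⊗ₜ[k] y + y ⊗ₜ[k] x + 1 ⊗ₜ[k] (x * y) := by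
  rw [Bialgebra.comul_mul, T.primitive_x, T.primitive_y]
  simp [add_mul, mul_add]
  abel

theorem cobarDifferential_x : cobarDifferential k C (cobarOne k x) = 0 := by
  rw [cobarDifferential_cobarOne, T.primitive_x]
  simp [cobarOne_one]

theorem cobarDifferential_y : cobarDifferential k C (cobarOne k y) = 0 := by
  rw [cobarDifferential_cobarOne, T.primitive_y]
  simp [cobarOne_one]

theorem cobarDifferential_z : cobarDifferential k C (cobarOne k z) =
    cobarOne k x * cobarOne k y - cobarOne k y * cobarOne k x := by
  rw [cobarDifferential_cobarOne, T.comul_z]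
  simp [cobarOne_one]

theorem cobarDifferential_xy : cobarDifferential k C (cobarOne k (x * y)) =
    cobarOne k x * cobarOne k y + cobarOne k y * cobarOne k x := by
  rw [cobarDifferential_cobarOne, T.comul_xy]
  simp [cobarOne_one]

theorem cobarU_mem : cobarU k x y z ∈ cobarCocycles k C 2 := by
  refine ⟨add_mem (add_mem (sub_mem ?_ ?_) ?_) ?_, ?_⟩
  any_goals exact cobarOne_mul_cobarOne_mem k _ _
  change cobarDifferential k C (cobarU k x y z) = 0
  rw [cobarU]
  simp only [map_add, map_sub, cobarDifferential_mul k (cobarOne_mem k _),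
    T.cobarDifferential_x, T.cobarDifferential_z, T.cobarDifferential_xy]
  noncomm_ring

theorem cobarT_mem : cobarT k x y z ∈ cobarCocycles k C 2 := by
  refine ⟨add_mem (add_mem (sub_mem ?_ ?_) ?_) ?_, ?_⟩
  any_goals exact cobarOne_mul_cobarOne_mem k _ _
  change cobarDifferential k C (cobarT k x y z) = 0
  rw [cobarT]
  simp only [map_add, map_sub, cobarDifferential_mul k (cobarOne_mem k _),
    T.cobarDifferential_y, T.cobarDifferential_z, T.cobarDifferential_xy]
  noncomm_ring

theorem slice_cobarU {f : C →ₗ[k] k} (hf : f 1 = 0) :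
    slice f (cobarU k x y z) = f x • z - f z • x + f x • (x * y) + f (x * y) • x := by
  simp [cobarU, slice_cobarOne_mul hf, T.counit_x, T.counit_z]

theorem slice_cobarT {f : C →ₗ[k] k} (hf : f 1 = 0) :
    slice f (cobarT k x y z) = f z • y - f y • z + f y • (x * y) + f (x * y) • y := by
  simp [cobarT, slice_cobarOne_mul hf, T.counit_x, T.counit_y, T.counit_z]

theorem hit_z (f : C →ₗ[k] k) : hit f z = f z • 1 + f y • x - f x • y + f 1 • z := by
  rw [hit_apply, T.comul_z]
  simp

theorem hit_xy (f : C →ₗ[k] k) :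
    hit f (x * y) = f 1 • (x * y) + f y • x + f x • y + f (x * y) • 1 := by
  rw [hit_apply, T.comul_xy]
  simp

omit T in
/-- The obstruction to integrating the pair `(slice ξ w, slice η w)`, for `f = ξ` or `f = η`. -/
def obstruction (ξ η f : C →ₗ[k] k) : Cobar k C →ₗ[k] C :=
  hit f ∘ₗ (hit ξ ∘ₗ slice η - hit η ∘ₗ slice ξ) - hitComm ξ η ∘ₗ slice f

omit T in
theorem obstruction_apply (f : C →ₗ[k] k) (w : Cobar k C) : obstruction ξ η f w =
    hit f (hit ξ (slice η w) - hit η (slice ξ w)) - hitComm ξ η (slice f w) := rfl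

/-- Only the leading parts `z + xy` and `0` of the slices along `ξ` and `η` matter: `-ξ η (z + xy) =
-ξ(2x + const) = -2`, and `[ξ,η](z + xy) = 2` is subtracted. -/
theorem obstruction_ξ_cobarU : obstruction ξ η ξ (cobarU k x y z) = (-4 : k) • 1 := by
  simp only [obstruction_apply, hitComm_apply, T.slice_cobarU T.ξ_one, T.slice_cobarU T.η_one,
    map_add, map_sub, map_smul, T.hit_z, T.hit_xy, hit_primitive T.primitive_x,
    hit_primitive T.primitive_y, hit_one, T.ξ_one, T.η_one, T.ξ_x, T.ξ_y, T.η_x, T.η_y]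
  module

theorem obstruction_η_cobarU : obstruction ξ η η (cobarU k x y z) = 0 := by
  simp only [obstruction_apply, hitComm_apply, T.slice_cobarU T.ξ_one, T.slice_cobarU T.η_one,
    map_add, map_sub, map_smul, T.hit_z, T.hit_xy, hit_primitive T.primitive_x,
    hit_primitive T.primitive_y, hit_one, T.ξ_one, T.η_one, T.ξ_x, T.ξ_y, T.η_x, T.η_y]
  module

theorem obstruction_ξ_cobarT : obstruction ξ η ξ (cobarT k x y z) = 0 := by
  simp only [obstruction_apply, hitComm_apply, T.slice_cobarT T.ξ_one, T.slice_cobarT T.η_one,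
    map_add, map_sub, map_smul, T.hit_z, T.hit_xy, hit_primitive T.primitive_x,
    hit_primitive T.primitive_y, hit_one, T.ξ_one, T.η_one, T.ξ_x, T.ξ_y, T.η_x, T.η_y]
  module

theorem obstruction_η_cobarT : obstruction ξ η η (cobarT k x y z) = (4 : k) • 1 := by
  simp only [obstruction_apply, hitComm_apply, T.slice_cobarT T.ξ_one, T.slice_cobarT T.η_one,
    map_add, map_sub, map_smul, T.hit_z, T.hit_xy, hit_primitive T.primitive_x,
    hit_primitive T.primitive_y, hit_one, T.ξ_one, T.η_one, T.ξ_x, T.ξ_y, T.η_x, T.η_y]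
  module

theorem slice_cobarU_mem {f : C →ₗ[k] k} (hf : f 1 = 0) :
    slice f (cobarU k x y z) ∈ weightFil k x y z 2 := by
  rw [T.slice_cobarU hf]
  refine add_mem (add_mem (sub_mem ?_ ?_) ?_) ?_ <;> refine Submodule.smul_mem _ _ ?_
  · exact z_mem
  · exact mem_weightFil_of_le (by omega) x_mem
  · exact mem_weightFil_of_le (m := 1 + 1) (by omega) (mul_mem_weightFil x_mem y_mem)
  · exact mem_weightFil_of_le (by omega) x_mem

theorem slice_cobarT_mem {f : C →ₗ[k] k} (hf : f 1 = 0) :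
    slice f (cobarT k x y z) ∈ weightFil k x y z 2 := by
  rw [T.slice_cobarT hf]
  refine add_mem (add_mem (sub_mem ?_ ?_) ?_) ?_ <;> refine Submodule.smul_mem _ _ ?_
  · exact mem_weightFil_of_le (by omega) y_mem
  · exact z_mem
  · exact mem_weightFil_of_le (m := 1 + 1) (by omega) (mul_mem_weightFil x_mem y_mem)
  · exact mem_weightFil_of_le (by omega) y_mem

theorem obstruction_cobarDifferential {f : C →ₗ[k] k} (hf : f 1 = 0) (c : C) :
    obstruction ξ η f (cobarDifferential k C (cobarOne k c)) =
      hit f (hitComm ξ η c) - hitComm ξ η (hit f c) := by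
  simp only [obstruction_apply, slice_cobarDifferential_cobarOne T.ξ_one,
    slice_cobarDifferential_cobarOne T.η_one, slice_cobarDifferential_cobarOne hf, map_sub,
    map_smul, hitComm_apply, hit_one, T.ξ_one, T.η_one]
  simp

theorem obstruction_mem_sub_two {f : C →ₗ[k] k} (hf : f 1 = 0) {n : ℤ} {w : Cobar k C}
    (hξ : slice ξ w ∈ weightFil k x y z n) (hη : slice η w ∈ weightFil k x y z n)
    (hs : slice f w ∈ weightFil k x y z n) :
    obstruction ξ η f w ∈ weightFil k x y z (n - 2) :=
  mem_weightFil_of_le (by omega) (sub_mem (T.hit_mem_sub_one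
    (sub_mem (T.hit_ξ_mem hη) (T.hit_η_mem hξ)) hf)
    (mem_weightFil_of_le (by omega) (T.hitComm_mem hs)))

/-- The error has weight at most `3 - 4 < 0`. -/
theorem hit_ξ_hitComm_eq {c : C} (hc : c ∈ weightFil k x y z 3) :
    hit ξ (hitComm ξ η c) = hitComm ξ η (hit ξ c) :=
  sub_eq_zero.1 (eq_zero_of_mem_weightFil (by omega) (T.hit_ξ_hitComm_mem hc))

theorem hit_η_hitComm_eq {c : C} (hc : c ∈ weightFil k x y z 3) :
    hit η (hitComm ξ η c) = hitComm ξ η (hit η c) :=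
  sub_eq_zero.1 (eq_zero_of_mem_weightFil (by omega) (T.hit_η_hitComm_mem hc))

section CharZero

variable [CharZero k]

/-- Modulo the counit, `ξ` and `η`, every functional vanishes in weight one, hence is a sum of
products ending in `ξ` or `η`; so all slices vanish. -/
theorem slice_eq_zero_imp {w : Cobar k C} (hw : w ∈ cobarCocycles k C 2)
    (hξ : slice ξ w = 0) (hη : slice η w = 0) : w = 0 := by
  refine eq_zero_of_slice_eq_zero hw.1 fun h => ?_
  let h' : C →ₗ[k] k := h - h 1 • Coalgebra.counit (R := k) (A := C) - h x • ξ - h y • η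
  have h'_one : h' 1 = 0 := by simp [h', T.ξ_one, T.η_one]
  have h'_x : h' x = 0 := by simp [h', T.ξ_x, T.η_x, T.counit_x]
  have h'_y : h' y = 0 := by simp [h', T.ξ_y, T.η_y, T.counit_y]
  obtain ⟨f, g, hf, hg, hfg⟩ := T.exists_factorization (m := 1) (by omega) h' fun c hc => by
    obtain ⟨a, b, d, rfl⟩ := mem_weightFil_one hc
    simp only [map_add, map_smul, h'_one, h'_x, h'_y, smul_zero, add_zero]
  have e : slice h' w = 0 := by
    rw [hfg, slice_add _ _ hw.1,
      slice_comp_hit (hf 1 (one_mem_weightFil (by omega))) T.ξ_one hw,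
      slice_comp_hit (hg 1 (one_mem_weightFil (by omega))) T.η_one hw, hξ, hη]
    simp
  simpa only [h', slice_sub _ _ hw.1, slice_smul _ _ hw.1, slice_counit hw.1, hξ, hη, smul_zero,
    sub_zero] using e

/-- Up to a constant, the obstruction is the slice of `w` along the convolution bracket `[f,
[ξ,η]]`. That functional vanishes in weight three, so it is `p ξ + q η` with `p`, `q` vanishing in
weight two, and these lower the weight of the slices by three. The constants have weight `0 ≤ n -
3`, which is where `3 ≤ n` is needed. -/
theorem obstruction_mem {f : C →ₗ[k] k} (hf : f 1 = 0)
    (hcomm : ∀ c ∈ weightFil k x y z 3, hit f (hitComm ξ η c) = hitComm ξ η (hit f c))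
    {n : ℤ} (hn : 3 ≤ n) {w : Cobar k C} (hw : w ∈ cobarCocycles k C 2)
    (hξ : slice ξ w ∈ weightFil k x y z n) (hη : slice η w ∈ weightFil k x y z n) :
    obstruction ξ η f w ∈ weightFil k x y z (n - 3) := by
  have h1 : ∀ s : k, s • (1 : C) ∈ weightFil k x y z (n - 3) :=
    fun s => Submodule.smul_mem _ _ (one_mem_weightFil (by omega))
  let r : C →ₗ[k] k := Coalgebra.counit ∘ₗ (hit f ∘ₗ hitComm ξ η - hitComm ξ η ∘ₗ hit f)
  have hr : slice r w ∈ weightFil k x y z (n - 3) := by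
    obtain ⟨p, q, hp, hq, hpq⟩ := T.exists_factorization (m := 3) (by omega) r fun c hc => by
      simp [r, hcomm c hc]
    rw [hpq, slice_add _ _ hw.1,
      slice_comp_hit (hp 1 (one_mem_weightFil (by omega))) T.ξ_one hw,
      slice_comp_hit (hq 1 (one_mem_weightFil (by omega))) T.η_one hw]
    refine add_mem (sub_mem ?_ (h1 _)) (sub_mem ?_ (h1 _))
    · exact mem_weightFil_of_le (by omega) (T.hit_mem hξ _ p hp)
    · exact mem_weightFil_of_le (by omega) (T.hit_mem hη _ q hq)
  have hr' : r = f ∘ₗ hit ξ ∘ₗ hit η - f ∘ₗ hit η ∘ₗ hit ξ - ξ ∘ₗ hit η ∘ₗ hit f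
      + η ∘ₗ hit ξ ∘ₗ hit f := by
    ext c
    simp only [r, hitComm_apply, LinearMap.comp_apply, LinearMap.sub_apply, LinearMap.add_apply,
      map_sub, counit_hit]
    ring
  obtain ⟨s₁, hs₁⟩ := exists_slice_comp_hit_comp_hit hf T.ξ_one T.η_one hw
  obtain ⟨s₂, hs₂⟩ := exists_slice_comp_hit_comp_hit hf T.η_one T.ξ_one hw
  obtain ⟨s₃, hs₃⟩ := exists_slice_comp_hit_comp_hit T.ξ_one T.η_one hf hw
  obtain ⟨s₄, hs₄⟩ := exists_slice_comp_hit_comp_hit T.η_one T.ξ_one hf hw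
  rw [hr', slice_add _ _ hw.1, slice_sub _ _ hw.1, slice_sub _ _ hw.1, hs₁, hs₂, hs₃, hs₄] at hr
  convert add_mem hr (h1 (s₁ - s₂ - s₃ + s₄)) using 1
  simp only [obstruction_apply, hitComm_apply, map_sub, sub_smul, add_smul]
  abel

/-- Lowering the weight of the slices of a cocycle by subtracting a coboundary. -/
theorem exists_slice_sub_mem {n : ℤ} (hn : 2 ≤ n) {w : Cobar k C}
    (hξ : slice ξ w ∈ weightFil k x y z (n - 1)) (hη : slice η w ∈ weightFil k x y z (n - 1))
    (h₁ : obstruction ξ η ξ w ∈ weightFil k x y z (n - 4))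
    (h₂ : obstruction ξ η η w ∈ weightFil k x y z (n - 4)) :
    ∃ v ∈ cobarDegree k C 1,
      slice ξ (w - cobarDifferential k C v) ∈ weightFil k x y z (n - 2) ∧
      slice η (w - cobarDifferential k C v) ∈ weightFil k x y z (n - 2) := by
  obtain ⟨c, -, hc₁, hc₂⟩ := T.exists_hit_sub_mem (by omega) hξ hη h₁ h₂
  refine ⟨cobarOne k c, cobarOne_mem k c, ?_, ?_⟩
  · rw [map_sub, slice_cobarDifferential_cobarOne T.ξ_one]
    -- The slice of `∂[c]` differs from `hit ξ c` by the constant `ξ c`, admissible since `0 ≤ n -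
    -- 2`.
    convert sub_mem (Submodule.smul_mem _ (ξ c) (one_mem_weightFil (by omega))) hc₁ using 1
    abel
  · rw [map_sub, slice_cobarDifferential_cobarOne T.η_one]
    convert sub_mem (Submodule.smul_mem _ (η c) (one_mem_weightFil (by omega))) hc₂ using 1
    abel

/-- Descent on the weight of the slices. In weight zero they are constants killed by the counit,
hence zero, and so is the cocycle. -/
theorem exists_eq_of_slice_mem (n : ℕ) : ∀ w ∈ cobarCocycles k C 2,
    slice ξ w ∈ weightFil k x y z n → slice η w ∈ weightFil k x y z n →
    ∃ a b : k, ∃ v ∈ cobarDegree k C 1,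
      w = a • cobarU k x y z + b • cobarT k x y z + cobarDifferential k C v := by
  induction n with
  | zero =>
    intro w hw hξ hη
    have key : ∀ f : C →ₗ[k] k, slice f w ∈ weightFil k x y z 0 → slice f w = 0 := by
      intro f h
      obtain ⟨s, hs⟩ := mem_weightFil_zero h
      have := counit_slice f hw.1
      rw [hs, map_smul, Bialgebra.counit_one, smul_eq_mul, mul_one] at this
      rw [hs, this, zero_smul]
    exact ⟨0, 0, 0, zero_mem _, by simp [T.slice_eq_zero_imp hw (key ξ hξ) (key η hη)]⟩
  | succ n ih =>
    have step : ∀ w ∈ cobarCocycles k C 2,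
        slice ξ w ∈ weightFil k x y z (n + 1 : ℕ) → slice η w ∈ weightFil k x y z (n + 1 : ℕ) →
        obstruction ξ η ξ w ∈ weightFil k x y z ((n + 1 : ℕ) - 3 : ℤ) →
        obstruction ξ η η w ∈ weightFil k x y z ((n + 1 : ℕ) - 3 : ℤ) →
        ∃ a b : k, ∃ v ∈ cobarDegree k C 1,
          w = a • cobarU k x y z + b • cobarT k x y z + cobarDifferential k C v := by
      intro w hw hξ hη h₁ h₂
      obtain ⟨v, hv, hv₁, hv₂⟩ := T.exists_slice_sub_mem (n := n + 2) (by omega)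
        (mem_weightFil_of_le (by push_cast; omega) hξ)
        (mem_weightFil_of_le (by push_cast; omega) hη)
        (mem_weightFil_of_le (by push_cast; omega) h₁)
        (mem_weightFil_of_le (by push_cast; omega) h₂)
      obtain ⟨a, b, v', hv', h⟩ := ih _ (sub_mem hw (cobarDifferential_mem_cobarCocycles hv))
        (mem_weightFil_of_le (by omega) hv₁) (mem_weightFil_of_le (by omega) hv₂)
      refine ⟨a, b, v' + v, add_mem hv' hv, ?_⟩
      rw [map_add, ← add_assoc, ← h, sub_add_cancel]
    intro w hw hξ hη
    have h₁ := T.obstruction_mem_sub_two T.ξ_one hξ hη hξ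
    have h₂ := T.obstruction_mem_sub_two T.η_one hξ hη hη
    rcases lt_trichotomy n 1 with hn | hn | hn
    -- Slices of weight one: the obstructions have weight `-1` and vanish.
    · obtain rfl : n = 0 := by omega
      refine step w hw hξ hη ?_ ?_
      · rw [eq_zero_of_mem_weightFil (by simp) h₁]
        exact zero_mem _
      · rw [eq_zero_of_mem_weightFil (by simp) h₂]
        exact zero_mem _
    · subst hn
      obtain ⟨d₁, hd₁⟩ := mem_weightFil_zero (by simpa using h₁)
      obtain ⟨d₂, hd₂⟩ := mem_weightFil_zero (by simpa using h₂)
      -- Slices of weight two are the only case with a genuine obstruction, the constants `d₁` and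
      -- `d₂`. The coefficients `d₁ / 4` and `-d₂ / 4` cancel them against the values `-4` and `4`
      -- on `u` and `t`.
      obtain ⟨a, b, v, hv, h⟩ := step
        (w + (d₁ / 4) • cobarU k x y z - (d₂ / 4) • cobarT k x y z)
        (sub_mem (add_mem hw (Submodule.smul_mem _ _ T.cobarU_mem))
          (Submodule.smul_mem _ _ T.cobarT_mem))
        (by
          rw [map_sub, map_add, map_smul, map_smul]
          exact sub_mem (add_mem hξ (Submodule.smul_mem _ _ (T.slice_cobarU_mem T.ξ_one)))
            (Submodule.smul_mem _ _ (T.slice_cobarT_mem T.ξ_one)))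
        (by
          rw [map_sub, map_add, map_smul, map_smul]
          exact sub_mem (add_mem hη (Submodule.smul_mem _ _ (T.slice_cobarU_mem T.η_one)))
            (Submodule.smul_mem _ _ (T.slice_cobarT_mem T.η_one)))
        (by
          rw [map_sub, map_add, map_smul, map_smul, T.obstruction_ξ_cobarU,
            T.obstruction_ξ_cobarT, hd₁, smul_smul, smul_zero, sub_zero, ← add_smul,
            show d₁ + d₁ / 4 * -4 = 0 by field_simp; ring, zero_smul]
          exact zero_mem _)
        (by
          rw [map_sub, map_add, map_smul, map_smul, T.obstruction_η_cobarU,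
            T.obstruction_η_cobarT, hd₂, smul_smul, smul_zero, add_zero, ← sub_smul,
            show d₂ - d₂ / 4 * 4 = 0 by field_simp; ring, zero_smul]
          exact zero_mem _)
      refine ⟨a - d₁ / 4, b + d₂ / 4, v, hv, ?_⟩
      rw [eq_sub_of_add_eq (sub_eq_iff_eq_add.1 h)]
      module
    · exact step w hw hξ hη
        (T.obstruction_mem T.ξ_one (fun _ => T.hit_ξ_hitComm_eq) (by push_cast; omega) hw hξ hη)
        (T.obstruction_mem T.η_one (fun _ => T.hit_η_hitComm_eq) (by push_cast; omega) hw hξ hη)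

/-- Every `2`-cocycle is a combination of `u` and `t`, up to a coboundary. -/
theorem exists_eq_of_mem_cobarCocycles {w : Cobar k C} (hw : w ∈ cobarCocycles k C 2) :
    ∃ a b : k, ∃ v ∈ cobarDegree k C 1,
      w = a • cobarU k x y z + b • cobarT k x y z + cobarDifferential k C v := by
  obtain ⟨m, hm⟩ := exists_mem_weightFil T.adjoin_eq_top (slice ξ w)
  obtain ⟨n, hn⟩ := exists_mem_weightFil T.adjoin_eq_top (slice η w)
  exact T.exists_eq_of_slice_mem (m + n) w hw (mem_weightFil_of_le (by push_cast; omega) hm)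
    (mem_weightFil_of_le (by push_cast; omega) hn)

/-- No nontrivial combination of `u` and `t` is a coboundary. -/
theorem eq_zero_of_eq_cobarDifferential {a b : k} {v : Cobar k C} (hv : v ∈ cobarDegree k C 1)
    (h : a • cobarU k x y z + b • cobarT k x y z = cobarDifferential k C v) :
    a = 0 ∧ b = 0 := by
  have h10 : (1 : C) ≠ 0 := fun h0 => by
    have := T.ξ_x
    rw [← mul_one x, h0, mul_zero, map_zero] at this
    exact zero_ne_one this
  obtain ⟨c, rfl⟩ := exists_cobarOne hv
  have hmem : ∀ f : C →ₗ[k] k, f 1 = 0 → hit f c ∈ weightFil k x y z (3 - 1) := by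
    intro f hf
    have h' := congrArg (slice f) h
    rw [slice_cobarDifferential_cobarOne hf, map_add, map_smul, map_smul] at h'
    rw [sub_eq_iff_eq_add.1 h'.symm]
    exact add_mem (add_mem (Submodule.smul_mem _ _ (T.slice_cobarU_mem hf))
      (Submodule.smul_mem _ _ (T.slice_cobarT_mem hf)))
      (Submodule.smul_mem _ _ (one_mem_weightFil (by omega)))
  -- Since `u` and `t` have slices of weight two, `c` has weight three. There `[ξ,η]` commutes
  -- exactly with `ξ` and `η`, so `∂[c]` has zero obstruction, while the left side has obstructions
  -- `-4a` and `4b`.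
  have hc := T.mem_of_hit_mem (m := 3) (by omega) (hmem ξ T.ξ_one) (hmem η T.η_one)
  have h₁ := congrArg (obstruction ξ η ξ) h
  have h₂ := congrArg (obstruction ξ η η) h
  rw [T.obstruction_cobarDifferential T.ξ_one, T.hit_ξ_hitComm_eq hc, sub_self, map_add, map_smul,
    map_smul, T.obstruction_ξ_cobarU, T.obstruction_ξ_cobarT, smul_zero, add_zero, smul_smul,
    smul_eq_zero_iff_left h10] at h₁
  rw [T.obstruction_cobarDifferential T.η_one, T.hit_η_hitComm_eq hc, sub_self, map_add, map_smul,
    map_smul, T.obstruction_η_cobarU, T.obstruction_η_cobarT, smul_zero, zero_add, smul_smul,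
    smul_eq_zero_iff_left h10] at h₂
  exact ⟨by simpa using h₁, by simpa using h₂⟩

end CharZero
end ThinTriple
end Cocycles

/-! ### Growth of algebras with two almost commuting generators -/

section Growth

variable {k A : Type*} [Field k] [Ring A] [Algebra k A]

variable (k) in
/-- The span of the monomials `p ^ i * q ^ j` with `i + j ≤ n`. -/
def monomialSpan (p q : A) (n : ℕ) : Submodule k A :=
  Submodule.span k ((fun i : ℕ × ℕ => p ^ i.1 * q ^ i.2) ''
    ((Finset.range (n + 1) ×ˢ Finset.range (n + 1)).filter fun i => i.1 + i.2 ≤ n : Finset (ℕ × ℕ)))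

variable {p q : A}

instance (n : ℕ) : FiniteDimensional k (monomialSpan k p q n) :=
  FiniteDimensional.span_of_finite k ((Finset.finite_toSet _).image _)

theorem finrank_monomialSpan_le (n : ℕ) :
    Module.finrank k (monomialSpan k p q n) ≤ (n + 1) ^ 2 := by
  classical
  rw [monomialSpan, ← Finset.coe_image]
  refine (finrank_span_finset_le_card _).trans (Finset.card_image_le.trans
    ((Finset.card_filter_le _ _).trans ?_))
  simp [pow_two]

theorem pow_mul_pow_mem_monomialSpan {i j n : ℕ} (h : i + j ≤ n) :
    p ^ i * q ^ j ∈ monomialSpan k p q n :=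
  Submodule.subset_span ⟨(i, j), by simp; omega, rfl⟩

theorem monomialSpan_le {n : ℕ} {S : Submodule k A}
    (h : ∀ i j : ℕ, i + j ≤ n → p ^ i * q ^ j ∈ S) : monomialSpan k p q n ≤ S := by
  refine Submodule.span_le.2 ?_
  rintro _ ⟨⟨i, j⟩, hij, rfl⟩
  simp only [Finset.coe_filter, Set.mem_ofPred_eq] at hij
  exact h i j hij.2

theorem one_mem_monomialSpan (n : ℕ) : (1 : A) ∈ monomialSpan k p q n := by
  have h : p ^ 0 * q ^ 0 ∈ monomialSpan k p q n := pow_mul_pow_mem_monomialSpan (by omega)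
  simpa using h

theorem p_mem_monomialSpan : p ∈ monomialSpan k p q 1 := by
  have h : p ^ 1 * q ^ 0 ∈ monomialSpan k p q 1 := pow_mul_pow_mem_monomialSpan (by omega)
  simpa using h

theorem q_mem_monomialSpan : q ∈ monomialSpan k p q 1 := by
  have h : p ^ 0 * q ^ 1 ∈ monomialSpan k p q 1 := pow_mul_pow_mem_monomialSpan (by omega)
  simpa using h

theorem monomialSpan_mono {m n : ℕ} (h : m ≤ n) : monomialSpan k p q m ≤ monomialSpan k p q n :=
  monomialSpan_le fun _ _ hij => pow_mul_pow_mem_monomialSpan (hij.trans h)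

theorem mul_q_mem_monomialSpan {n : ℕ} {c : A} (hc : c ∈ monomialSpan k p q n) :
    c * q ∈ monomialSpan k p q (n + 1) := by
  have : monomialSpan k p q n ≤ (monomialSpan k p q (n + 1)).comap (LinearMap.mulRight k q) :=
    monomialSpan_le fun i j hij => by
      rw [Submodule.mem_comap, LinearMap.mulRight_apply, mul_assoc, ← pow_succ]
      exact pow_mul_pow_mem_monomialSpan (by omega)
  exact this hc

theorem pow_p_mul_mem_monomialSpan {n : ℕ} (i : ℕ) {c : A} (hc : c ∈ monomialSpan k p q n) :
    p ^ i * c ∈ monomialSpan k p q (i + n) := by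
  have : monomialSpan k p q n ≤
      (monomialSpan k p q (i + n)).comap (LinearMap.mulLeft k (p ^ i)) :=
    monomialSpan_le fun i' j hij => by
      rw [Submodule.mem_comap, LinearMap.mulLeft_apply, ← mul_assoc, ← pow_add]
      exact pow_mul_pow_mem_monomialSpan (by omega)
  exact this hc

variable {a b : k} (hpq : q * p = p * q + a • p + b • q)
include hpq

/-- The relation `hpq` moves `p` leftwards past each `q` at the cost of terms of no larger degree;
hence ordered monomials suffice. -/
theorem pow_q_mul_p_mem_monomialSpan (j : ℕ) : q ^ j * p ∈ monomialSpan k p q (j + 1) := by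
  induction j with
  | zero => simpa using p_mem_monomialSpan
  | succ j ih =>
    have e : q ^ (j + 1) * p = q ^ j * p * q + a • (q ^ j * p) + b • (p ^ 0 * q ^ (j + 1)) := by
      rw [pow_succ, mul_assoc, hpq]
      simp [mul_add, mul_assoc]
    rw [e]
    exact add_mem (add_mem (mul_q_mem_monomialSpan ih)
      (Submodule.smul_mem _ _ (monomialSpan_mono (by omega) ih)))
      (Submodule.smul_mem _ _ (pow_mul_pow_mem_monomialSpan (by omega)))

theorem mul_p_mem_monomialSpan {n : ℕ} {c : A} (hc : c ∈ monomialSpan k p q n) :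
    c * p ∈ monomialSpan k p q (n + 1) := by
  have : monomialSpan k p q n ≤ (monomialSpan k p q (n + 1)).comap (LinearMap.mulRight k p) :=
    monomialSpan_le fun i j hij => by
      rw [Submodule.mem_comap, LinearMap.mulRight_apply, mul_assoc]
      exact monomialSpan_mono (by omega)
        (pow_p_mul_mem_monomialSpan i (pow_q_mul_p_mem_monomialSpan hpq j))
  exact this hc

theorem mul_mem_monomialSpan {m n : ℕ} {c d : A} (hc : c ∈ monomialSpan k p q m)
    (hd : d ∈ monomialSpan k p q n) : c * d ∈ monomialSpan k p q (m + n) := by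
  have hp : ∀ i : ℕ, c * p ^ i ∈ monomialSpan k p q (m + i) := by
    intro i
    induction i with
    | zero => simpa using hc
    | succ i ih =>
      rw [pow_succ, ← mul_assoc]
      exact mul_p_mem_monomialSpan hpq ih
  have hq : ∀ i j : ℕ, c * p ^ i * q ^ j ∈ monomialSpan k p q (m + i + j) := by
    intro i j
    induction j with
    | zero => simpa using hp i
    | succ j ih =>
      rw [pow_succ, ← mul_assoc]
      exact mul_q_mem_monomialSpan ih
  have : monomialSpan k p q n ≤ (monomialSpan k p q (m + n)).comap (LinearMap.mulLeft k c) :=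
    monomialSpan_le fun i j hij => by
      rw [Submodule.mem_comap, LinearMap.mulLeft_apply, ← mul_assoc]
      exact monomialSpan_mono (by omega) (hq i j)
  exact this hd

theorem exists_mem_monomialSpan (h : Algebra.adjoin k {p, q} = ⊤) (c : A) :
    ∃ n, c ∈ monomialSpan k p q n := by
  have hc : c ∈ Algebra.adjoin k {p, q} := h ▸ Algebra.mem_top
  induction hc using Algebra.adjoin_induction with
  | mem c hc =>
    rcases hc with rfl | rfl
    · exact ⟨1, p_mem_monomialSpan⟩
    · exact ⟨1, q_mem_monomialSpan⟩
  | algebraMap r =>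
    refine ⟨0, ?_⟩
    rw [Algebra.algebraMap_eq_smul_one]
    exact Submodule.smul_mem _ _ (one_mem_monomialSpan 0)
  | add c d _ _ hc hd =>
    obtain ⟨m, hc⟩ := hc
    obtain ⟨n, hd⟩ := hd
    exact ⟨m + n, add_mem (monomialSpan_mono (by omega) hc) (monomialSpan_mono (by omega) hd)⟩
  | mul c d _ _ hc hd =>
    obtain ⟨m, hc⟩ := hc
    obtain ⟨n, hd⟩ := hd
    exact ⟨m + n, mul_mem_monomialSpan hpq hc hd⟩

theorem exists_pow_le_monomialSpan (h : Algebra.adjoin k {p, q} = ⊤) (V : Submodule k A)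
    [FiniteDimensional k V] : ∃ d : ℕ, ∀ n : ℕ, (1 ⊔ V) ^ n ≤ monomialSpan k p q (d * n) := by
  obtain ⟨s, hs⟩ := (Module.Finite.iff_fg (N := V)).1 inferInstance
  choose N hN using exists_mem_monomialSpan hpq h
  have hV : 1 ⊔ V ≤ monomialSpan k p q (s.sup N) := by
    refine sup_le ?_ ?_
    · rw [Submodule.one_le]
      exact one_mem_monomialSpan _
    · rw [← hs, Submodule.span_le]
      exact fun c hc => monomialSpan_mono (Finset.le_sup (f := N) hc) (hN c)
  refine ⟨s.sup N, fun n => ?_⟩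
  induction n with
  | zero =>
    rw [pow_zero, Submodule.one_le]
    exact one_mem_monomialSpan _
  | succ n ih =>
    rw [pow_succ]
    exact Submodule.mul_le.2 fun c hc d hd => mul_mem_monomialSpan hpq (ih hc) (hV hd)

/-- The dimension of `(1 ⊔ V) ^ n` is at most `(d n + 1)²`, which for positive `n` is at most `((d +
1) n)²`; the factor `d + 1` disappears after dividing logarithms by `log n`. -/
theorem gkDim_le_two (h : Algebra.adjoin k {p, q} = ⊤) : gkDim k A ≤ 2 := by
  refine iSup₂_le fun V _ => ?_
  obtain ⟨d, hd⟩ := exists_pow_le_monomialSpan hpq h V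
  have hlog : Filter.Tendsto (fun n : ℕ => Real.log n) Filter.atTop Filter.atTop :=
    Real.tendsto_log_atTop.comp tendsto_natCast_atTop_atTop
  have hlim : Filter.Tendsto
      (fun n : ℕ => ((2 * Real.log (d + 1) / Real.log n + 2 : ℝ) : EReal))
      Filter.atTop (nhds 2) := by
    have := (hlog.const_div_atTop (2 * Real.log (d + 1))).add_const 2
    rw [zero_add] at this
    exact (continuous_coe_real_ereal.tendsto _).comp this
  rw [← hlim.limsup_eq]
  refine Filter.limsup_le_limsup ?_
  filter_upwards [Filter.eventually_ge_atTop 2] with n hn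
  rw [EReal.coe_le_coe_iff]
  have hn2 : (2 : ℝ) ≤ n := by exact_mod_cast hn
  have hlogn : 0 < Real.log n := Real.log_pos (by linarith)
  have hle : (Module.finrank k ↥((1 ⊔ V) ^ n) : ℝ) ≤ (((d : ℝ) + 1) * n) ^ 2 := by
    have h1 : Module.finrank k ↥((1 ⊔ V) ^ n) ≤ (d * n + 1) ^ 2 :=
      (Submodule.finrank_mono (hd n)).trans (finrank_monomialSpan_le _)
    have h2 : d * n + 1 ≤ (d + 1) * n := by
      rw [add_mul]
      omega
    exact_mod_cast h1.trans (Nat.pow_le_pow_left h2 2)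
  have hd0 : (0 : ℝ) < d + 1 := by positivity
  have hmain : Real.log (Module.finrank k ↥((1 ⊔ V) ^ n)) ≤
      2 * Real.log (d + 1) + 2 * Real.log n := by
    -- The degenerate case is harmless because `Real.log 0 = 0` by convention.
    rcases Nat.eq_zero_or_pos (Module.finrank k ↥((1 ⊔ V) ^ n)) with h0 | h0
    · rw [h0, Nat.cast_zero, Real.log_zero]
      have : 0 ≤ Real.log (d + 1) := Real.log_nonneg (by linarith [Nat.cast_nonneg (α := ℝ) d])
      positivity
    · refine (Real.log_le_log (by exact_mod_cast h0) hle).trans_eq ?_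
      rw [Real.log_pow, Real.log_mul hd0.ne' (by positivity)]
      push_cast
      ring
  rw [div_le_iff₀ hlogn, add_mul, div_mul_cancel₀ _ hlogn.ne']
  exact hmain

end Growth

/-! ### From the hypotheses on `C` to a thin triple. -/

section Thin

variable {k C : Type*} [Field k] [Ring C] [HopfAlgebra k C]

theorem isPrimitiveElt_commutator {p q : C} (hp : IsPrimitiveElt k p) (hq : IsPrimitiveElt k q) :
    IsPrimitiveElt k (q * p - p * q) := by
  unfold IsPrimitiveElt at hp hq ⊢
  rw [map_sub, Bialgebra.comul_mul, Bialgebra.comul_mul, hp, hq]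
  simp [add_mul, mul_add, TensorProduct.sub_tmul, TensorProduct.tmul_sub]
  abel

/-- If `x` and `y` were dependent, `x ⊗ y - y ⊗ x` would vanish and `z` would be primitive. A basis
of the primitives would then generate `C`, and as their commutator is again primitive,
`gkDim_le_two` would apply. -/
theorem linearIndependent_of_gkDim (hP : Module.finrank k (primitiveSubmodule k C) = 2)
    (hgk : 2 < gkDim k C) {x y z : C} (hx : IsPrimitiveElt k x) (hy : IsPrimitiveElt k y)
    (hz : Coalgebra.comul (R := k) z = 1 ⊗ₜ[k] z + x ⊗ₜ[k] y - y ⊗ₜ[k] x + z ⊗ₜ[k] 1)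
    (hgen : Algebra.adjoin k {x, y, z} = ⊤) : LinearIndependent k ![x, y] := by
  by_contra hli
  have hxy : x ⊗ₜ[k] y = y ⊗ₜ[k] x := by
    by_cases hx0 : x = 0
    · simp [hx0]
    · rw [LinearIndependent.pair_iff' hx0] at hli
      push Not at hli
      obtain ⟨r, rfl⟩ := hli
      rw [TensorProduct.tmul_smul, TensorProduct.smul_tmul']
  have hz' : IsPrimitiveElt k z := by
    rw [IsPrimitiveElt, hz, hxy]
    abel
  have : Module.Finite k (primitiveSubmodule k C) := Module.finite_of_finrank_pos (by omega)
  let b := Module.finBasisOfFinrankEq k (primitiveSubmodule k C) hP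
  have hb : ∀ c : C, IsPrimitiveElt k c → ∃ r s : k, c = r • (b 0 : C) + s • (b 1 : C) := by
    intro c hc
    have h := congrArg Subtype.val (b.sum_repr ⟨c, hc⟩)
    rw [Fin.sum_univ_two] at h
    exact ⟨_, _, h.symm⟩
  obtain ⟨r, s, hrs⟩ := hb _ (isPrimitiveElt_commutator (b 0).2 (b 1).2)
  refine hgk.not_ge (gkDim_le_two (p := (b 0 : C)) (q := (b 1 : C)) (a := r) (b := s) ?_ ?_)
  · rw [add_assoc, ← hrs]
    abel
  · refine top_le_iff.1 (hgen ▸ Algebra.adjoin_le ?_)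
    have key : ∀ c : C, IsPrimitiveElt k c →
        c ∈ Algebra.adjoin k {(b 0 : C), (b 1 : C)} := by
      intro c hc
      obtain ⟨r, s, rfl⟩ := hb c hc
      exact add_mem (Subalgebra.smul_mem _ (Algebra.subset_adjoin (by simp)) _)
        (Subalgebra.smul_mem _ (Algebra.subset_adjoin (by simp)) _)
    rintro c (rfl | rfl | rfl)
    exacts [key _ hx, key _ hy, key _ hz']

theorem exists_dual_functional {x y : C} (hx : IsPrimitiveElt k x) (hy : IsPrimitiveElt k y)
    (hli : LinearIndependent k ![x, y]) (r s : k) :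
    ∃ f : C →ₗ[k] k, f 1 = 0 ∧ f x = r ∧ f y = s := by
  obtain ⟨g, hg⟩ := ((Module.Basis.span hli).constr k ![r, s]).exists_extend
  have h : ∀ i, g (![x, y] i) = ![r, s] i := by
    intro i
    have h1 := (Module.Basis.span hli).constr_basis k ![r, s] i
    rw [← hg, LinearMap.comp_apply, Submodule.subtype_apply, Module.Basis.span_apply] at h1
    exact h1
  -- Subtracting a multiple of the counit normalises the value at 1 without changing the values on
  -- primitives.
  refine ⟨g - g 1 • Coalgebra.counit (R := k) (A := C), by simp, ?_, ?_⟩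
  · simpa [counit_eq_zero_of_primitive hx] using h 0
  · simpa [counit_eq_zero_of_primitive hy] using h 1

theorem exists_eq_add_of_primitive (hP : Module.finrank k (primitiveSubmodule k C) = 2)
    {x y : C} (hx : IsPrimitiveElt k x) (hy : IsPrimitiveElt k y)
    (hli : LinearIndependent k ![x, y]) {c : C} (hc : IsPrimitiveElt k c) :
    ∃ a b : k, c = a • x + b • y := by
  have : Module.Finite k (primitiveSubmodule k C) := Module.finite_of_finrank_pos (by omega)
  have hle : Submodule.span k (Set.range ![x, y]) ≤ primitiveSubmodule k C := by
    rw [Submodule.span_le]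
    rintro _ ⟨i, rfl⟩
    fin_cases i
    exacts [hx, hy]
  have heq := Submodule.eq_of_le_of_finrank_eq hle (by rw [finrank_span_eq_card hli, hP]; simp)
  have hmem : c ∈ Submodule.span k (Set.range ![x, y]) := heq ▸ hc
  rw [Matrix.range_cons, Matrix.range_cons, Matrix.range_empty, Set.union_empty,
    Set.singleton_union, Submodule.mem_span_pair] at hmem
  obtain ⟨a, b, h⟩ := hmem
  exact ⟨a, b, h.symm⟩

/-- In a primitively-thin Hopf algebra of Gelfand–Kirillov dimension greater than two, generators
`x`, `y`, `z` as in `ThinTriple` commute up to terms of lower weight. -/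
theorem exists_thinTriple (hP : Module.finrank k (primitiveSubmodule k C) = 2)
    (hgk : 2 < gkDim k C) {x y z : C} (hx : IsPrimitiveElt k x) (hy : IsPrimitiveElt k y)
    (hz : Coalgebra.comul (R := k) z = 1 ⊗ₜ[k] z + x ⊗ₜ[k] y - y ⊗ₜ[k] x + z ⊗ₜ[k] 1)
    (hgen : Algebra.adjoin k {x, y, z} = ⊤) : ∃ ξ η, ThinTriple k x y z ξ η := by
  have hli := linearIndependent_of_gkDim hP hgk hx hy hz hgen
  obtain ⟨ξ, ξ_one, ξ_x, ξ_y⟩ := exists_dual_functional hx hy hli 1 0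
  obtain ⟨η, η_one, η_x, η_y⟩ := exists_dual_functional hx hy hli 0 1
  obtain ⟨a, b, hab⟩ := exists_eq_add_of_primitive hP hx hy hli (isPrimitiveElt_commutator hy hx)
  have hprim : ∀ c : C, IsPrimitiveElt k c → c ∈ weightFil k x y z 1 := by
    intro c hc
    obtain ⟨a, b, rfl⟩ := exists_eq_add_of_primitive hP hx hy hli hc
    exact add_mem (Submodule.smul_mem _ _ x_mem) (Submodule.smul_mem _ _ y_mem)
  -- With `[x,y] = a x + b y`, the reduced coproduct of `[x,z]` is `x ⊗ [x,y] - [x,y] ⊗ x = b (x ⊗ y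
  -- - y ⊗ x)`, which is that of `b z`. For `[y,z]` the same computation gives that of `-a z`.
  have hxx : IsPrimitiveElt k (x * z - z * x - b • z) := by
    have e : Coalgebra.comul (R := k) (x * z - z * x) = (x * z - z * x) ⊗ₜ[k] 1
        + 1 ⊗ₜ[k] (x * z - z * x) + x ⊗ₜ[k] (x * y - y * x) - (x * y - y * x) ⊗ₜ[k] x := by
      rw [map_sub, Bialgebra.comul_mul, Bialgebra.comul_mul, hz, hx]
      simp [add_mul, mul_add, mul_sub, sub_mul, TensorProduct.sub_tmul, TensorProduct.tmul_sub]
      abel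
    rw [IsPrimitiveElt, map_sub, e, hab, map_smul, hz]
    simp only [TensorProduct.sub_tmul, TensorProduct.tmul_sub, TensorProduct.add_tmul,
      TensorProduct.tmul_add, ← TensorProduct.smul_tmul', TensorProduct.tmul_smul]
    module
  have hyy : IsPrimitiveElt k (y * z - z * y + a • z) := by
    have e : Coalgebra.comul (R := k) (y * z - z * y) = (y * z - z * y) ⊗ₜ[k] 1
        + 1 ⊗ₜ[k] (y * z - z * y) - (x * y - y * x) ⊗ₜ[k] y + y ⊗ₜ[k] (x * y - y * x) := by
      rw [map_sub, Bialgebra.comul_mul, Bialgebra.comul_mul, hz, hy]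
      simp [add_mul, mul_add, mul_sub, sub_mul, TensorProduct.sub_tmul, TensorProduct.tmul_sub]
      abel
    rw [IsPrimitiveElt, map_add, e, hab, map_smul, hz]
    simp only [TensorProduct.sub_tmul, TensorProduct.tmul_sub, TensorProduct.add_tmul,
      TensorProduct.tmul_add, ← TensorProduct.smul_tmul', TensorProduct.tmul_smul]
    module
  refine ⟨ξ, η, hx, hy, hz, hprim _ (isPrimitiveElt_commutator hy hx), ?_, ?_, hgen, ξ_one, ξ_x,
    ξ_y, η_one, η_x, η_y⟩
  · rw [← sub_add_cancel (x * z - z * x) (b • z)]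
    exact add_mem (mem_weightFil_of_le (by omega) (hprim _ hxx)) (Submodule.smul_mem _ _ z_mem)
  · rw [← add_sub_cancel_right (y * z - z * y) (a • z)]
    exact sub_mem (mem_weightFil_of_le (by omega) (hprim _ hyy)) (Submodule.smul_mem _ _ z_mem)

end Thin

end ThinHopf

end

/-! ### The classes of `u` and `t` form a basis of `H²`. -/

theorem proposition4p10 {k C : Type*} [Field k] [CharZero k] [Ring C] [HopfAlgebra k C]
    (hthin : IsPrimitivelyThin k C) (hgk : gkDim k C = 3)
    (x y z : C) (hx : IsPrimitiveElt k x) (hy : IsPrimitiveElt k y)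
    (hz : Coalgebra.comul (R := k) z =
      1 ⊗ₜ[k] z + x ⊗ₜ[k] y - y ⊗ₜ[k] x + z ⊗ₜ[k] 1)
    (hgen : Algebra.adjoin k {x, y, z} = ⊤) :
    ∃ (hu : cobarU k x y z ∈ cobarCocycles k C 2)
      (ht : cobarT k x y z ∈ cobarCocycles k C 2),
      Submodule.span k {cobarClass k (cobarU k x y z) hu, cobarClass k (cobarT k x y z) ht} = ⊤ ∧
      Module.finrank k (CobarCohomology k C 2) = 2 := by
  have h23 : (2 : EReal) < 3 := by exact_mod_cast (by norm_num : (2 : ℝ) < 3)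
  obtain ⟨ξ, η, T⟩ := ThinHopf.exists_thinTriple hthin.finrank_primitive (hgk ▸ h23) hx hy hz hgen
  refine ⟨T.cobarU_mem, T.cobarT_mem, ?_⟩
  set cu := cobarClass k (cobarU k x y z) T.cobarU_mem with hcu
  set ct := cobarClass k (cobarT k x y z) T.cobarT_mem with hct
  have hspan : Submodule.span k {cu, ct} = ⊤ := by
    rw [eq_top_iff]
    rintro c -
    obtain ⟨⟨w, hw⟩, rfl⟩ := Submodule.Quotient.mk_surjective _ c
    obtain ⟨a, b, v, hv, h⟩ := T.exists_eq_of_mem_cobarCocycles hw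
    refine Submodule.mem_span_pair.2 ⟨a, b, ?_⟩
    rw [hcu, hct, cobarClass, cobarClass, ← Submodule.Quotient.mk_smul,
      ← Submodule.Quotient.mk_smul, ← Submodule.Quotient.mk_add, eq_comm, Submodule.Quotient.eq]
    refine ⟨v, hv, ?_⟩
    change cobarDifferential k C v = w - (a • cobarU k x y z + b • cobarT k x y z)
    rw [h, add_sub_cancel_left]
  have hli : LinearIndependent k ![cu, ct] := by
    rw [LinearIndependent.pair_iff]
    intro a b h
    rw [hcu, hct, cobarClass, cobarClass, ← Submodule.Quotient.mk_smul,
      ← Submodule.Quotient.mk_smul, ← Submodule.Quotient.mk_add, Submodule.Quotient.mk_eq_zero] at h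
    obtain ⟨v, hv, h⟩ := h
    exact T.eq_zero_of_eq_cobarDifferential hv h.symm
  refine ⟨hspan, ?_⟩
  have h := finrank_span_eq_card hli
  rwa [Matrix.range_cons, Matrix.range_cons, Matrix.range_empty, Set.union_empty,
    Set.singleton_union, hspan, finrank_top, Fintype.card_fin] at h
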